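/- Let $G$ be a simple graph on $[L]=\{1,\dots,L\}$ with clique number $\omega(G)$ (the largest number of vertices of a complete subgraph). Let $\mathcal A$ be a unital $C^*$-algebra with a faithful tracial state $\tau$, and let $s_1,\dots,s_L\in\mathcal A$ be $G$-independent semicircular elements, in the following sense. (a) Each $s_i$ is self-adjoint and $\tau(s_i^n)=\int_{-2}^{2}t^n\,\frac{\sqrt{4-t^2}}{2\pi}\,dt$ for all integers $n\ge 0$. (b) Let $\mathcal A_i$ be the unital subalgebra of $\mathcal A$ generated by $s_i$. If $\{i,j\}$ is an edge of $G$, then $\mathcal A_i$ and $\mathcal A_j$ are classically independent: their elements commute, and $\tau(bc)=0$ for all $b\in\mathcal A_i$, $c\in\mathcal A_j$ with $\tau(b)=\tau(c)=0$. (c) Let $k\ge 1$ and $(i_1,\dots,i_k)\in[L]^k$ be such that whenever $j_1<j_2$ and $i_{j_1}=i_{j_2}$, there is $j_3$ with $j_1<j_3<j_2$ such that $\{i_{j_1},i_{j_3}\}$ is not an edge of $G$. Then $\tau(b_1\cdots b_k)=0$ for all $b_j\in\mathcal A_{i_j}$ with $\tau(b_j)=0$, $1\le j\le k$. Then for every complex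 Hilbert space $\mathcal H$ and all bounded operators $a_1,\dots,a_L\in B(\mathcal H)$, $$\Big\|\sum_{i=1}^{L}a_i\otimes s_i\Big\|_{B(\mathcal H)\otimes\mathcal A}\;\le\;2\sqrt{\omega(G)}\,\max\Big\{\Big\|\sum_{i=1}^{L}a_ia_i^*\Big\|^{1/2},\ \Big\|\sum_{i=1}^{L}a_i^*a_i\Big\|^{1/2}\Big\},$$ where $B(\mathcal H)\otimes\mathcal A$ is the minimal tensor product of $C^*$-algebras, i.e. the norm on the left is $\sup_{\pi,\rho}\big\|\sum_{i}\pi(a_i)\otimes\rho(s_i)\big\|$ over all unital $*$-representations $\pi$ of $B(\mathcal H)$ and $\rho$ of $\mathcal A$ on Hilbert spaces (the supremum is attained when $\pi$ and $\rho$ are faithful). -/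

import Mathlib

open scoped TensorProduct ComplexOrder

/-! ### Noncommutative probability: faithful traces, semicircular elements, `G`-independence -/

section Probability

/-- `τ` is a faithful tracial state on the unital C⋆-algebra `A`, so that `(A, τ)` is a
C⋆-probability space with a faithful trace. -/
structure IsFaithfulTrace {A : Type*} [CStarAlgebra A] (τ : A →ₗ[ℂ] ℂ) : Prop where
  map_one : τ 1 = 1
  nonneg : ∀ a : A, 0 ≤ τ (star a * a)
  faithful : ∀ a : A, τ (star a * a) = 0 → a = 0
  tracial : ∀ a b : A, τ (a * b) = τ (b * a)

/-- `s` is a (standard) semicircular element: it is self-adjoint and its distribution with respect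
to `τ` is the semicircle law of mean `0` and variance `1`, with density `√(4 - t²) / (2π)` on
`[-2, 2]`. -/
structure IsSemicircular {A : Type*} [CStarAlgebra A] (τ : A →ₗ[ℂ] ℂ) (s : A) : Prop where
  isSelfAdjoint : IsSelfAdjoint s
  moments : ∀ n : ℕ,
    τ (s ^ n) = ((∫ t in (-2 : ℝ)..2, t ^ n * (√(4 - t ^ 2) / (2 * Real.pi)) : ℝ) : ℂ)

/-- Classical independence of two unital subalgebras: they commute, and products of centered
elements are centered. -/
structure ClassicallyIndependent {A : Type*} [CStarAlgebra A] (τ : A →ₗ[ℂ] ℂ)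
    (B C : Subalgebra ℂ A) : Prop where
  commute : ∀ b ∈ B, ∀ c ∈ C, b * c = c * b
  centered : ∀ b ∈ B, ∀ c ∈ C, τ b = 0 → τ c = 0 → τ (b * c) = 0

/-- `G`-independence of a family of unital subalgebras indexed by the vertices of `G`. -/
structure GIndependent {A : Type*} [CStarAlgebra A] (τ : A →ₗ[ℂ] ℂ) {L : ℕ}
    (G : SimpleGraph (Fin L)) (B : Fin L → Subalgebra ℂ A) : Prop where
  classical : ∀ i j : Fin L, G.Adj i j → ClassicallyIndependent τ (B i) (B j)
  mixed : ∀ (k : ℕ), 1 ≤ k → ∀ (i : Fin k → Fin L),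
    (∀ j₁ j₂ : Fin k, j₁ < j₂ → i j₁ = i j₂ →
      ∃ j₃ : Fin k, j₁ < j₃ ∧ j₃ < j₂ ∧ ¬ G.Adj (i j₁) (i j₃)) →
    ∀ a : Fin k → A, (∀ j, a j ∈ B (i j)) → (∀ j, τ (a j) = 0) →
      τ (List.ofFn a).prod = 0

/-- Elements `s₁, …, s_L` are `G`-independent when the unital subalgebras that they generate are
(for self-adjoint elements, these are the generated unital ⋆-subalgebras). -/
def GIndependentElements {A : Type*} [CStarAlgebra A] (τ : A →ₗ[ℂ] ℂ) {L : ℕ}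
    (G : SimpleGraph (Fin L)) (s : Fin L → A) : Prop :=
  GIndependent τ G fun i => Algebra.adjoin ℂ {s i}

end Probability

/-! ### The minimal (spatial) tensor norm of two unital C⋆-algebras -/

section MinimalTensorNorm

universe u v

/-- For representations `π` of `A` on `H` and `ρ` of `B` on `K`, the linear map `π ⊗ ρ` from the
algebraic tensor product `A ⊗ B` to the bounded operators on `H ⊗ K`, with
`(π ⊗ ρ) (a ⊗ b) = π a ⊗ ρ b`. Here `H ⊗ K` is the algebraic tensor product with its
inner product; bounded operators on it have the same norm as their extensions to the Hilbert space
completion. -/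
noncomputable def tensorRep {A : Type u} {B : Type v} [CStarAlgebra A] [CStarAlgebra B]
    {H : Type u} [NormedAddCommGroup H] [InnerProductSpace ℂ H] [CompleteSpace H]
    {K : Type v} [NormedAddCommGroup K] [InnerProductSpace ℂ K] [CompleteSpace K]
    (π : A →⋆ₐ[ℂ] (H →L[ℂ] H)) (ρ : B →⋆ₐ[ℂ] (K →L[ℂ] K)) :
    A ⊗[ℂ] B →ₗ[ℂ] (H ⊗[ℂ] K →L[ℂ] H ⊗[ℂ] K) :=
  TensorProduct.lift <|
    LinearMap.mk₂ ℂ (fun a b => TensorProduct.mapL (π a) (ρ b))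
      (fun a₁ a₂ b => by simp [TensorProduct.mapL_add_left])
      (fun c a b => by simp [TensorProduct.mapL_smul_left])
      (fun a b₁ b₂ => by simp [TensorProduct.mapL_add_right])
      (fun c a b => by simp [TensorProduct.mapL_smul_right])

/-- The values `‖(π ⊗ ρ) x‖` for all pairs of representations `π` of `A` and `ρ` of `B` on Hilbert
spaces. (The universal representation of a C⋆-algebra lives in the universe of the algebra.) -/
def tensorRepNorms {A : Type u} {B : Type v} [CStarAlgebra A] [CStarAlgebra B]
    (x : A ⊗[ℂ] B) : Set ℝ :=
  {r | ∃ (H : Type u) (_ : NormedAddCommGroup H) (_ : InnerProductSpace ℂ H)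
      (_ : CompleteSpace H) (K : Type v) (_ : NormedAddCommGroup K)
      (_ : InnerProductSpace ℂ K) (_ : CompleteSpace K)
      (π : A →⋆ₐ[ℂ] (H →L[ℂ] H)) (ρ : B →⋆ₐ[ℂ] (K →L[ℂ] K)), r = ‖tensorRep π ρ x‖}

/-- The minimal C⋆-norm on the algebraic tensor product `A ⊗ B`: the supremum of `‖(π ⊗ ρ) x‖`
over all pairs of representations. It is attained at every pair of faithful representations, i.e.
it is the norm of `x` in `B(H ⊗ K)` for any embeddings `A ⊆ B(H)` and `B ⊆ B(K)`. -/
noncomputable def minTensorNorm {A : Type u} {B : Type v} [CStarAlgebra A] [CStarAlgebra B]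
    (x : A ⊗[ℂ] B) : ℝ :=
  sSup (tensorRepNorms x)

/-- The supremum that defines the minimal norm is finite. -/
theorem bddAbove_tensorRepNorms {A : Type u} {B : Type v} [CStarAlgebra A] [CStarAlgebra B]
    (x : A ⊗[ℂ] B) : BddAbove (tensorRepNorms x) := by
  induction x using TensorProduct.induction_on with
  | zero =>
    refine ⟨0, ?_⟩
    rintro r ⟨H, _, _, _, K, _, _, _, π, ρ, rfl⟩
    rw [map_zero]
    exact ContinuousLinearMap.opNorm_zero.le
  | tmul a b =>
    refine ⟨‖a‖ * ‖b‖, ?_⟩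
    rintro r ⟨H, _, _, _, K, _, _, _, π, ρ, rfl⟩
    refine (TensorProduct.norm_mapL_le (π a) (ρ b)).trans ?_
    exact mul_le_mul (NonUnitalStarAlgHom.norm_apply_le π a)
      (NonUnitalStarAlgHom.norm_apply_le ρ b) (norm_nonneg _) (norm_nonneg _)
  | add x y hx hy =>
    obtain ⟨C, hC⟩ := hx
    obtain ⟨D, hD⟩ := hy
    refine ⟨C + D, ?_⟩
    rintro r ⟨H, h₁, h₂, h₃, K, k₁, k₂, k₃, π, ρ, rfl⟩
    have hx := hC ⟨H, h₁, h₂, h₃, K, k₁, k₂, k₃, π, ρ, rfl⟩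
    have hy := hD ⟨H, h₁, h₂, h₃, K, k₁, k₂, k₃, π, ρ, rfl⟩
    rw [map_add]
    exact (ContinuousLinearMap.opNorm_add_le _ _).trans (add_le_add hx hy)

end MinimalTensorNorm

/-!
# Norms of operator-valued sums of `G`-independent semicircular elements

The estimate is a computation in a Fock space. Let `M` be the trace monoid of `G`: words in the
vertices, where neighbouring letters that are adjacent in `G` may be exchanged. The Chebyshev
polynomials of a single semicircular element extend to polynomials `P_q` in `s₁, …, s_L`, one for
each `q ∈ M`, with `s i * P_q = P_{iq} + P_{i⁻¹q}`, where the last term is present only when `i`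
divides `q` from the left. For `q ≠ 1` the polynomial `P_q` is a product of centered one-variable
polynomials along a reduced sequence of letters (`exists_syllables`), and `G`-independence gives
`τ (P_q) = 0`. Moving `s i` from one side of the inner product to the other then shows that the `P_q`
are orthonormal in `L²(A, τ)` (`map_star_chebTrace_mul_chebTrace`). Hence `s i` acts on their span
as `ℓ i + (ℓ i)⋆`, where `ℓ i` is the creation operator `q ↦ iq`.

The letters that divide a given `q ∈ M` from the left commute pairwise, and so they form a clique,
with at most `ω = G.cliqueNum` elements. By the Cauchy–Schwarz inequality over these letters,
`‖∑ b i ⊗ ℓ i‖² ≤ ω ‖∑ (b i)⋆ b i‖`, and similarly `‖∑ b i ⊗ (ℓ i)⋆‖² ≤ ω ‖∑ b i (b i)⋆‖`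
(`SimpleGraph.tsum_enorm_sq_creation_add_annihilation_le`).

It remains to pass from `L²(A, τ)` to arbitrary representations. Compressing the first tensor factor
to finite-dimensional subspaces (`opNorm_le_of_forall_compression`) reduces the claim to the norm of
`Y = ∑ α i ⊗ s i` in the C⋆-algebra of matrices over `A`, with scalar matrices `α i`. The functional
`Tr ⊗ τ` is faithful there, and the norm of `star Y * Y` is at most the growth rate of its moments
(`IsSelfAdjoint.norm_le_of_moments_le`), which the `L²` estimate bounds.
-/

/-! ### The trace monoid of a graph -/

namespace SimpleGraph

variable {V : Type*} [DecidableEq V] (G : SimpleGraph V)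

/-- Two words in the vertices of `G` are equivalent when they differ by exchanges of neighbouring
letters that are adjacent in `G`. This is encoded through the projections of the words to the pairs
of non-adjacent letters (with `i = j` allowed), which form a complete set of invariants. -/
def traceSetoid : Setoid (List V) where
  r w w' := ∀ i j, ¬ G.Adj i j →
    w.filter (fun x => x = i ∨ x = j) = w'.filter (fun x => x = i ∨ x = j)
  iseqv := ⟨fun _ _ _ _ => rfl, fun h i j hij => (h i j hij).symm,
    fun h h' i j hij => (h i j hij).trans (h' i j hij)⟩

/-- The letter `i` divides the word `w` from the left in the trace monoid. -/
def Leads (i : V) (w : List V) : Prop :=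
  ∀ j, ¬ G.Adj i j → (w.filter (fun x => x = i ∨ x = j)).head? = some i

variable {G}

theorem traceSetoid_iff {w w' : List V} : G.traceSetoid w w' ↔ ∀ i j, ¬ G.Adj i j →
    w.filter (fun x => x = i ∨ x = j) = w'.filter (fun x => x = i ∨ x = j) := Iff.rfl

theorem traceSetoid_cons_iff {i : V} {w w' : List V} :
    G.traceSetoid (i :: w) (i :: w') ↔ G.traceSetoid w w' := by
  simp only [traceSetoid_iff]
  refine forall_congr' fun k => forall_congr' fun l => imp_congr_right fun _ => ?_
  by_cases h : i = k ∨ i = l <;> simp [h]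

theorem traceSetoid_swap {i j : V} (h : G.Adj i j) (w : List V) :
    G.traceSetoid (i :: j :: w) (j :: i :: w) := by
  intro k l hkl
  have hne := h.ne
  by_cases h1 : i = k ∨ i = l <;> by_cases h2 : j = k ∨ j = l
  · exfalso
    rcases h1 with rfl | rfl <;> rcases h2 with rfl | rfl
    · exact hne rfl
    · exact hkl h
    · exact hkl h.symm
    · exact hne rfl
  all_goals simp [h1, h2]

theorem traceSetoid.perm {w w' : List V} (h : G.traceSetoid w w') : w.Perm w' := by
  rw [List.perm_iff_count]
  intro a
  have := congrArg List.length (h a a (G.loopless.irrefl a))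
  simpa [List.count_eq_length_filter, beq_eq_decide] using this

theorem traceSetoid.length_eq {w w' : List V} (h : G.traceSetoid w w') : w.length = w'.length :=
  (traceSetoid.perm h).length_eq

theorem not_leads_nil (i : V) : ¬ G.Leads i [] := by
  intro h
  simpa using h i (G.loopless.irrefl i)

theorem leads_congr {i : V} {w w' : List V} (h : G.traceSetoid w w') :
    G.Leads i w ↔ G.Leads i w' := by
  refine forall_congr' fun j => imp_congr_right fun hj => ?_
  rw [h i j hj]

theorem leads_cons_iff {i j : V} {w : List V} :
    G.Leads i (j :: w) ↔ i = j ∨ (G.Adj i j ∧ G.Leads i w) := by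
  by_cases hij : i = j
  · subst hij
    simp [Leads]
  simp only [hij, false_or]
  constructor
  · intro h
    have hadj : G.Adj i j := by
      by_contra hadj
      have := h j hadj
      simp at this
      exact hij this.symm
    refine ⟨hadj, fun k hk => ?_⟩
    have hjk : j ≠ k := by rintro rfl; exact hk hadj
    have := h k hk
    simpa [hjk, Ne.symm hij] using this
  · rintro ⟨hadj, h⟩ k hk
    have hjk : j ≠ k := by rintro rfl; exact hk hadj
    simpa [hjk, Ne.symm hij] using h k hk

theorem leads_cons_self (i : V) (w : List V) : G.Leads i (i :: w) :=
  leads_cons_iff.2 (Or.inl rfl)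

theorem leads_cons_of_adj {i j : V} (h : G.Adj i j) {w : List V} :
    G.Leads i (j :: w) ↔ G.Leads i w := by
  simp [leads_cons_iff, h, h.ne]

theorem Leads.mem {i : V} {w : List V} (h : G.Leads i w) : i ∈ w := by
  induction w with
  | nil => exact absurd h (not_leads_nil i)
  | cons j w ih =>
    rcases leads_cons_iff.1 h with rfl | ⟨_, h⟩
    · simp
    · exact List.mem_cons_of_mem _ (ih h)

/-- The letters that divide a common word from the left pairwise commute. -/
theorem Leads.adj {i j : V} {w : List V} (hi : G.Leads i w) (hj : G.Leads j w) (hij : i ≠ j) :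
    G.Adj i j := by
  by_contra hadj
  have h1 := hi j hadj
  have h2 := hj i fun h => hadj h.symm
  simp only [or_comm] at h2
  rw [h1] at h2
  exact hij (Option.some.inj h2)

theorem Leads.cons_erase {i : V} {w : List V} (h : G.Leads i w) :
    G.traceSetoid (i :: w.erase i) w := by
  induction w with
  | nil => exact absurd h (not_leads_nil i)
  | cons j w ih =>
    rcases leads_cons_iff.1 h with rfl | ⟨hadj, h⟩
    · simp
    · rw [List.erase_cons_tail (by simpa using hadj.ne')]
      exact G.traceSetoid.trans (traceSetoid_swap hadj _) (traceSetoid_cons_iff.2 (ih h))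

theorem Leads.length_erase_lt {i : V} {w : List V} (h : G.Leads i w) :
    (w.erase i).length < w.length := by
  have := List.length_erase_add_one h.mem
  omega

theorem leads_erase_iff {i j : V} {w : List V} (hi : G.Leads i w) (h : G.Adj i j) :
    G.Leads j (w.erase i) ↔ G.Leads j w := by
  rw [← leads_congr (Leads.cons_erase hi), leads_cons_of_adj h.symm]

theorem Leads.erase_congr {i : V} {w w' : List V} (h : G.Leads i w) (hw : G.traceSetoid w w') :
    G.traceSetoid (w.erase i) (w'.erase i) := by
  rw [← traceSetoid_cons_iff (i := i)]
  exact G.traceSetoid.trans (Leads.cons_erase h) (G.traceSetoid.trans hw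
    (G.traceSetoid.symm (Leads.cons_erase ((leads_congr hw).1 h))))

/-- If two words starting with different letters are equivalent, then these letters commute and
both words start, up to equivalence, with both of them. -/
theorem traceSetoid_cons_cons {i j : V} {w w' : List V} (h : G.traceSetoid (i :: w) (j :: w'))
    (hij : i ≠ j) : G.Adj i j ∧ ∃ x : List V,
      G.traceSetoid w (j :: x) ∧ G.traceSetoid w' (i :: x) := by
  have hj : G.Leads j (i :: w) := (leads_congr h).2 (leads_cons_self j w')
  obtain ⟨hadj, hj⟩ := (leads_cons_iff.1 hj).resolve_left hij.symm
  refine ⟨hadj.symm, w.erase j, G.traceSetoid.symm hj.cons_erase, ?_⟩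
  rw [← traceSetoid_cons_iff (i := j)]
  refine G.traceSetoid.trans (G.traceSetoid.symm h) ?_
  refine G.traceSetoid.trans (traceSetoid_cons_iff.2 (G.traceSetoid.symm hj.cons_erase)) ?_
  exact traceSetoid_swap hadj.symm _

variable (G) in
/-- The trace monoid of `G`: words in the vertices, up to the exchange of neighbouring letters that
are adjacent in `G`. Only the left multiplication by letters is needed. -/
def Trace : Type _ := Quotient G.traceSetoid

namespace Trace

variable (G) in
/-- The empty word. -/
def nil : Trace G := Quotient.mk G.traceSetoid []

/-- Left multiplication by a letter. -/
def cons (i : V) : Trace G → Trace G :=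
  Quotient.map' (s₁ := G.traceSetoid) (s₂ := G.traceSetoid) (List.cons i)
    fun _ _ h => traceSetoid_cons_iff.2 h

/-- The class of a word. -/
def mk (w : List V) : Trace G := Quotient.mk G.traceSetoid w

theorem mk_eq_mk {w w' : List V} : (mk w : Trace G) = mk w' ↔ G.traceSetoid w w' :=
  Quotient.eq (r := G.traceSetoid)

theorem cons_mk (i : V) (w : List V) : cons i (mk w : Trace G) = mk (i :: w) := rfl

theorem exists_mk (q : Trace G) : ∃ w, mk w = q := Quotient.exists_rep q

theorem cons_injective (i : V) : Function.Injective (cons i : Trace G → Trace G) := by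
  intro p q h
  obtain ⟨w, rfl⟩ := exists_mk p
  obtain ⟨w', rfl⟩ := exists_mk q
  rw [cons_mk, cons_mk, mk_eq_mk, traceSetoid_cons_iff] at h
  exact mk_eq_mk.2 h

theorem exists_cons_eq_mk_iff {i : V} {w : List V} :
    (∃ p, cons i p = (mk w : Trace G)) ↔ G.Leads i w := by
  constructor
  · rintro ⟨p, hp⟩
    obtain ⟨w', rfl⟩ := exists_mk p
    exact (leads_congr (mk_eq_mk.1 hp)).1 (leads_cons_self i w')
  · exact fun h => ⟨mk (w.erase i), mk_eq_mk.2 h.cons_erase⟩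

/-- The letters that divide a given trace from the left form a clique. -/
theorem card_left_divisors_le [Fintype V] (q : Trace G) (S : Finset V)
    (hS : ∀ i ∈ S, ∃ p, cons i p = q) : S.card ≤ G.cliqueNum := by
  obtain ⟨w, rfl⟩ := exists_mk q
  refine IsClique.card_le_cliqueNum (tc := ?_)
  intro i hi j hj hij
  exact (exists_cons_eq_mk_iff.1 (hS i hi)).adj (exists_cons_eq_mk_iff.1 (hS j hj)) hij

end Trace

end SimpleGraph

/-! ### Multivariate Chebyshev polynomials on the trace monoid -/

namespace SimpleGraph

variable {V : Type*} [DecidableEq V] (G : SimpleGraph V) {A : Type*} [Ring A] (s : V → A)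

open Classical in
/-- The Chebyshev polynomial of a word, evaluated at `s`: it is determined by
`chebWord (i :: w) = s i * chebWord w - chebWord (i⁻¹ w)`, where the last term is present only when
`i` divides `w` from the left. The word `i⁻¹ w` is encoded as `w.erase i`. -/
noncomputable def chebWord : List V → A
  | [] => 1
  | i :: w => s i * chebWord w - if _h : G.Leads i w then chebWord (w.erase i) else 0
  termination_by w => w.length
  decreasing_by
  · simp
  · have := Leads.length_erase_lt ‹G.Leads i w›
    simp only [List.length_cons]
    omega

variable {G} {s}

theorem chebWord_cons_of_leads {i : V} {w : List V} (h : G.Leads i w) :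
    chebWord G s (i :: w) = s i * chebWord G s w - chebWord G s (w.erase i) := by
  rw [chebWord, dif_pos h]

theorem chebWord_cons_of_not_leads {i : V} {w : List V} (h : ¬ G.Leads i w) :
    chebWord G s (i :: w) = s i * chebWord G s w := by
  rw [chebWord, dif_neg h, sub_zero]

theorem chebWord_swap (hs : ∀ i j, G.Adj i j → s i * s j = s j * s i) {i j : V} (h : G.Adj i j)
    (w : List V) : chebWord G s (i :: j :: w) = chebWord G s (j :: i :: w) := by
  have hij : i ≠ j := h.ne
  have e1 : (j :: w).erase i = j :: w.erase i := List.erase_cons_tail (by simpa using hij.symm)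
  have e2 : (i :: w).erase j = i :: w.erase j := List.erase_cons_tail (by simpa using hij)
  have l1 : G.Leads i (j :: w) ↔ G.Leads i w := leads_cons_of_adj h
  have l2 : G.Leads j (i :: w) ↔ G.Leads j w := leads_cons_of_adj h.symm
  have hc : ∀ x : A, s i * (s j * x) = s j * (s i * x) := fun x => by
    rw [← mul_assoc, hs i j h, mul_assoc]
  by_cases hi : G.Leads i w <;> by_cases hj : G.Leads j w
  · have hj' : G.Leads j (w.erase i) := (leads_erase_iff hi h).2 hj
    have hi' : G.Leads i (w.erase j) := (leads_erase_iff hj h.symm).2 hi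
    rw [chebWord_cons_of_leads (l1.2 hi), chebWord_cons_of_leads (l2.2 hj), e1, e2,
      chebWord_cons_of_leads hi, chebWord_cons_of_leads hj, chebWord_cons_of_leads hi',
      chebWord_cons_of_leads hj', List.erase_comm, mul_sub, mul_sub, hc]
    abel
  · have hj' : ¬ G.Leads j (w.erase i) := fun h' => hj ((leads_erase_iff hi h).1 h')
    rw [chebWord_cons_of_leads (l1.2 hi), chebWord_cons_of_not_leads (mt l2.1 hj), e1,
      chebWord_cons_of_leads hi, chebWord_cons_of_not_leads hj, chebWord_cons_of_not_leads hj',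
      mul_sub, hc]
  · have hi' : ¬ G.Leads i (w.erase j) := fun h' => hi ((leads_erase_iff hj h.symm).1 h')
    rw [chebWord_cons_of_leads (l2.2 hj), chebWord_cons_of_not_leads (mt l1.1 hi), e2,
      chebWord_cons_of_leads hj, chebWord_cons_of_not_leads hi, chebWord_cons_of_not_leads hi',
      mul_sub, hc]
  · rw [chebWord_cons_of_not_leads (mt l1.1 hi), chebWord_cons_of_not_leads (mt l2.1 hj),
      chebWord_cons_of_not_leads hi, chebWord_cons_of_not_leads hj, hc]

theorem chebWord_congr (hs : ∀ i j, G.Adj i j → s i * s j = s j * s i) {w w' : List V}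
    (h : G.traceSetoid w w') : chebWord G s w = chebWord G s w' := by
  induction hn : w.length using Nat.strong_induction_on generalizing w w' with
  | _ n ih =>
  have hhead : ∀ (i : V) (u u' : List V), u.length < n → G.traceSetoid u u' →
      chebWord G s (i :: u) = chebWord G s (i :: u') := by
    intro i u u' hu huu
    by_cases hi : G.Leads i u
    · rw [chebWord_cons_of_leads hi, chebWord_cons_of_leads ((leads_congr huu).1 hi),
        ih _ hu huu rfl, ih _ (hi.length_erase_lt.trans hu) (hi.erase_congr huu) rfl]
    · rw [chebWord_cons_of_not_leads hi, chebWord_cons_of_not_leads (mt (leads_congr huu).2 hi),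
        ih _ hu huu rfl]
  match w, w', h with
  | [], [], _ => rfl
  | [], _ :: _, h => simpa using traceSetoid.length_eq h
  | _ :: _, [], h => simpa using traceSetoid.length_eq h
  | i :: u, j :: u', h =>
    have hlen : u.length < n := by simp [← hn]
    have hlen' : u'.length < n := by
      have := traceSetoid.length_eq h
      simp only [List.length_cons] at this hn
      omega
    by_cases hij : i = j
    · subst hij
      exact hhead i u u' hlen (traceSetoid_cons_iff.1 h)
    · -- both words are brought to the two orderings `i j x` and `j i x` of a common word
      obtain ⟨hadj, x, h1, h2⟩ := traceSetoid_cons_cons h hij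
      rw [hhead i u _ hlen h1, hhead j u' _ hlen' h2, chebWord_swap hs hadj]

/-- The Chebyshev polynomial of a trace, evaluated at a family `s` in which letters that are
adjacent in `G` commute. -/
noncomputable def chebTrace (hs : ∀ i j, G.Adj i j → s i * s j = s j * s i) (q : Trace G) : A :=
  Quotient.lift (s := G.traceSetoid) (chebWord G s) (fun _ _ h => chebWord_congr hs h) q

variable (hs : ∀ i j, G.Adj i j → s i * s j = s j * s i)

theorem chebTrace_mk (w : List V) : chebTrace hs (Trace.mk w) = chebWord G s w := rfl

theorem chebTrace_nil : chebTrace hs (Trace.nil G) = 1 := by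
  change chebWord G s [] = 1
  rw [chebWord]

theorem chebTrace_cons_cons (i : V) (p : Trace G) :
    s i * chebTrace hs (p.cons i) = chebTrace hs ((p.cons i).cons i) + chebTrace hs p := by
  obtain ⟨w, rfl⟩ := p.exists_mk
  simp only [Trace.cons_mk, chebTrace_mk, chebWord_cons_of_leads (leads_cons_self i w),
    List.erase_cons_head, sub_add_cancel]

theorem chebTrace_cons_of_forall_ne (i : V) (q : Trace G) (h : ∀ p, Trace.cons i p ≠ q) :
    s i * chebTrace hs q = chebTrace hs (q.cons i) := by
  obtain ⟨w, rfl⟩ := q.exists_mk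
  have hi : ¬ G.Leads i w := fun hi => by
    obtain ⟨p, hp⟩ := Trace.exists_cons_eq_mk_iff.2 hi
    exact h p hp
  simp only [Trace.cons_mk, chebTrace_mk, chebWord_cons_of_not_leads hi]

end SimpleGraph

namespace SimpleGraph

variable {V : Type*} [DecidableEq V]

/-! ### Syllables of reduced words -/

/-- A list of letters is reduced when no letter can be moved, by exchanges of adjacent letters, next
to an earlier copy of itself. -/
def IsReduced (G : SimpleGraph V) : List V → Prop
  | [] => True
  | i :: u => ¬ G.Leads i u ∧ G.IsReduced u

variable {G : SimpleGraph V}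

theorem leads_of_getElem {i : V} {u : List V} {k : ℕ} (hk : k < u.length) (hi : u[k] = i)
    (h : ∀ m (hm : m < k), G.Adj i u[m]) : G.Leads i u := by
  induction u generalizing k with
  | nil => simp at hk
  | cons j u ih =>
    rw [leads_cons_iff]
    cases k with
    | zero => exact Or.inl (by simpa using hi.symm)
    | succ k =>
      refine Or.inr ⟨by simpa using h 0 (by omega), ih (k := k) (by simpa using hk)
        (by simpa using hi) fun m hm => ?_⟩
      simpa using h (m + 1) (by omega)

theorem IsReduced.exists_not_adj {u : List V} (hu : G.IsReduced u) {j₁ j₂ : ℕ} (h₁ : j₁ < j₂)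
    (h₂ : j₂ < u.length) (h : u[j₁] = u[j₂]) :
    ∃ (j₃ : ℕ) (h₃ : j₃ < j₂), j₁ < j₃ ∧ ¬ G.Adj u[j₁] u[j₃] := by
  induction u generalizing j₁ j₂ with
  | nil => simp at h₂
  | cons i u ih =>
    obtain ⟨hi, hu⟩ := hu
    obtain ⟨j₂, rfl⟩ := Nat.exists_eq_succ_of_ne_zero (by omega : j₂ ≠ 0)
    have h₂' : j₂ < u.length := by simpa using h₂
    cases j₁ with
    | zero =>
      by_contra! hcon
      refine hi (leads_of_getElem h₂' (by simpa using h.symm) fun m hm => ?_)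
      simpa using hcon (m + 1) (by omega) (by omega)
    | succ j₁ =>
      obtain ⟨j₃, h₃, h₄, h₅⟩ := ih hu (j₁ := j₁) (j₂ := j₂) (by omega) h₂' (by simpa using h)
      exact ⟨j₃ + 1, by omega, by omega, by simpa using h₅⟩

/-- The maximal power of a letter can be extracted at the left of a word. -/
theorem exists_replicate_append (i : V) (w : List V) : ∃ (m : ℕ) (u : List V),
    G.traceSetoid w (List.replicate m i ++ u) ∧ ¬ G.Leads i u := by
  induction hn : w.length using Nat.strong_induction_on generalizing w with
  | _ n ih =>
  by_cases h : G.Leads i w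
  · obtain ⟨m, u, h1, h2⟩ := ih _ (hn ▸ h.length_erase_lt) (w.erase i) rfl
    refine ⟨m + 1, u, ?_, h2⟩
    exact G.traceSetoid.trans (G.traceSetoid.symm h.cons_erase) (traceSetoid_cons_iff.2 h1)
  · exact ⟨0, w, G.traceSetoid.refl w, h⟩

variable {A : Type*} [Ring A] [Algebra ℂ A] {s : V → A}

open Polynomial in
theorem chebWord_replicate_append (i : V) (u : List V) (hu : ¬ G.Leads i u) (m : ℕ) :
    chebWord G s (List.replicate m i ++ u) =
      aeval (s i) (Chebyshev.S ℂ m) * chebWord G s u := by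
  induction m using Nat.twoStepInduction with
  | zero => simp
  | one =>
    simp only [List.replicate_one, List.singleton_append, Nat.cast_one, Chebyshev.S_one, aeval_X]
    exact chebWord_cons_of_not_leads hu
  | more m ih1 ih2 =>
    have e : ∀ k, List.replicate (k + 1) i ++ u = i :: (List.replicate k i ++ u) := fun k => rfl
    rw [e (m + 1), chebWord_cons_of_leads (e m ▸ leads_cons_self i _), ih2, e m,
      List.erase_cons_head, ih1]
    push_cast
    rw [Chebyshev.S_add_two]
    simp [sub_mul, mul_assoc]

open Polynomial in
/-- The Chebyshev polynomial of a word is a product of one-variable Chebyshev polynomials of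
positive degrees along a reduced list of letters. -/
theorem exists_syllables (hs : ∀ i j, G.Adj i j → s i * s j = s j * s i) (w : List V) :
    ∃ r : List (V × ℕ), G.IsReduced (r.map Prod.fst) ∧
      chebWord G s w =
        (r.map fun x => aeval (s x.1) (Chebyshev.S ℂ ((x.2 + 1 : ℕ) : ℤ))).prod ∧
      (∀ i, G.Leads i w ↔ G.Leads i (r.map Prod.fst)) ∧ (r = [] → w = []) := by
  induction hn : w.length using Nat.strong_induction_on generalizing w with
  | _ n ih =>
  match w with
  | [] => exact ⟨[], trivial, by simp [chebWord], by simp, fun _ => rfl⟩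
  | i :: w =>
    obtain ⟨m, u, hmu, hu⟩ := exists_replicate_append (G := G) i w
    have hlen : u.length < n := by
      have := traceSetoid.length_eq hmu
      simp only [List.length_cons, List.length_append, List.length_replicate] at this hn
      omega
    obtain ⟨r, hr, hprod, hlead, -⟩ := ih _ hlen u rfl
    have hw : G.traceSetoid (i :: w) (List.replicate (m + 1) i ++ u) := traceSetoid_cons_iff.2 hmu
    refine ⟨(i, m) :: r, ⟨mt (hlead i).2 hu, hr⟩, ?_, fun j => ?_, by simp⟩
    · rw [chebWord_congr hs hw, chebWord_replicate_append i u hu, hprod]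
      simp
    · rw [leads_congr hw, List.map_cons, leads_cons_iff, ← hlead]
      clear hw hmu
      induction m with
      | zero => rw [List.replicate_one, List.singleton_append, leads_cons_iff]
      | succ m ihm =>
        rw [List.replicate_succ, List.cons_append, leads_cons_iff, ihm]
        tauto

end SimpleGraph

/-! ### The semicircle law and Chebyshev polynomials -/

section Semicircle

open Polynomial Real

/-- The Chebyshev polynomials `S n` of positive degree have mean zero for the semicircle law. -/
theorem integral_chebyshev_S_semicircle {n : ℕ} (hn : n ≠ 0) :
    ∫ t in (-2 : ℝ)..2, (Chebyshev.S ℝ n).eval t * (√(4 - t ^ 2) / (2 * π)) = 0 := by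
  have hsub := intervalIntegral.integral_comp_mul_deriv (a := 0) (b := π)
    (f := fun θ => 2 * cos θ) (f' := fun θ => 2 * -sin θ)
    (g := fun t => (Chebyshev.S ℝ n).eval t * (√(4 - t ^ 2) / (2 * π)))
    (fun θ _ => (hasDerivAt_cos θ).const_mul 2) (by fun_prop) (by fun_prop)
  simp only [cos_zero, cos_pi, mul_one, mul_neg] at hsub
  rw [intervalIntegral.integral_symm, ← hsub, neg_eq_zero]
  have hint : ∀ θ ∈ Set.uIcc 0 π,
      -(((fun t => (Chebyshev.S ℝ n).eval t * (√(4 - t ^ 2) / (2 * π))) ∘ fun θ => 2 * cos θ) θ *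
        (2 * sin θ)) = (1 / π) * (cos (((n : ℝ) + 2) * θ) - cos ((n : ℝ) * θ)) := by
    intro θ hθ
    rw [Set.uIcc_of_le pi_nonneg] at hθ
    have hsin : 0 ≤ sin θ := sin_nonneg_of_nonneg_of_le_pi hθ.1 hθ.2
    have hsq : √(4 - (2 * cos θ) ^ 2) = 2 * sin θ := by
      rw [← sqrt_sq (by positivity : 0 ≤ 2 * sin θ)]
      congr 1
      nlinarith [sin_sq_add_cos_sq θ]
    have hS := Chebyshev.S_two_mul_real_cos θ n
    have h1 : cos (((n : ℝ) + 2) * θ) - cos ((n : ℝ) * θ) =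
        -2 * sin (((n : ℤ) + 1) * θ) * sin θ := by
      rw [cos_sub_cos]
      push_cast
      congr 2 <;> ring_nf
    simp only [Function.comp_apply]
    rw [hsq, h1, ← hS]
    field_simp
  rw [intervalIntegral.integral_congr hint, intervalIntegral.integral_const_mul,
    intervalIntegral.integral_sub (Continuous.intervalIntegrable (by fun_prop) _ _)
      (Continuous.intervalIntegrable (by fun_prop) _ _)]
  have hcos : ∀ k : ℕ, k ≠ 0 → ∫ θ in (0 : ℝ)..π, cos ((k : ℝ) * θ) = 0 := by
    intro k hk
    rw [intervalIntegral.integral_comp_mul_left _ (Nat.cast_ne_zero.2 hk), integral_cos]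
    simp [sin_nat_mul_pi]
  have h2 := hcos (n + 2) (by omega)
  push_cast at h2
  rw [h2, hcos n hn]
  simp

variable {A : Type*} [CStarAlgebra A] {τ : A →ₗ[ℂ] ℂ} {s : A}

theorem IsSemicircular.map_aeval (hs : IsSemicircular τ s) (p : ℝ[X]) :
    τ (aeval s (p.map (algebraMap ℝ ℂ))) =
      ((∫ t in (-2 : ℝ)..2, p.eval t * (√(4 - t ^ 2) / (2 * π)) : ℝ) : ℂ) := by
  induction p using Polynomial.induction_on' with
  | add p q hp hq =>
    rw [Polynomial.map_add, map_add, map_add, hp, hq, ← Complex.ofReal_add,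
      ← intervalIntegral.integral_add]
    · simp only [eval_add, add_mul]
    all_goals exact Continuous.intervalIntegrable (by fun_prop) _ _
  | monomial n c =>
    have h := hs.moments n
    simp only [Polynomial.map_monomial, aeval_monomial, eval_monomial]
    rw [← Algebra.smul_def, map_smul, h]
    simp only [mul_assoc, intervalIntegral.integral_const_mul]
    simp

theorem IsSemicircular.map_chebyshev_S (hs : IsSemicircular τ s) {n : ℕ} (hn : n ≠ 0) :
    τ (aeval s (Chebyshev.S ℂ n)) = 0 := by
  rw [← Chebyshev.map_S (algebraMap ℝ ℂ), hs.map_aeval, integral_chebyshev_S_semicircle hn,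
    Complex.ofReal_zero]

end Semicircle

/-! ### Orthonormality of the Chebyshev polynomials of a `G`-independent semicircular family -/

section Orthonormal

open SimpleGraph Polynomial

variable {L : ℕ} {G : SimpleGraph (Fin L)} {A : Type*} [CStarAlgebra A] {τ : A →ₗ[ℂ] ℂ}
  {s : Fin L → A}

theorem GIndependentElements.commute (hG : GIndependentElements τ G s) (i j : Fin L)
    (h : G.Adj i j) : s i * s j = s j * s i :=
  (hG.classical i j h).commute _ (Algebra.self_mem_adjoin_singleton ℂ _) _
    (Algebra.self_mem_adjoin_singleton ℂ _)

theorem map_chebWord_eq_zero (hs : ∀ i, IsSemicircular τ (s i)) (hG : GIndependentElements τ G s)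
    {w : List (Fin L)} (hw : w ≠ []) : τ (chebWord G s w) = 0 := by
  obtain ⟨r, hr, hprod, -, hnil⟩ := exists_syllables hG.commute w
  set f : Fin L × ℕ → A := fun x => aeval (s x.1) (Chebyshev.S ℂ ((x.2 + 1 : ℕ) : ℤ)) with hf
  have hofFn : r.map f = List.ofFn fun j : Fin r.length => f r[j] := by
    refine List.ext_getElem (by simp) fun j h1 h2 => by simp
  rw [hprod, hofFn]
  refine hG.mixed r.length (List.length_pos_iff.2 (mt hnil hw)) (fun j => r[j].1) ?_ _ ?_ ?_
  · intro j₁ j₂ h12 heq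
    obtain ⟨j₃, h₃, h₄, h₅⟩ := hr.exists_not_adj (j₁ := j₁) (j₂ := j₂) h12 (by simp)
      (by simpa using heq)
    exact ⟨⟨j₃, h₃.trans j₂.2⟩, h₄, h₃, by simpa using h₅⟩
  · exact fun j => aeval_mem_adjoin_singleton ℂ _
  · exact fun j => (hs _).map_chebyshev_S (Nat.succ_ne_zero _)

open Classical in
/-- The Chebyshev polynomials indexed by the trace monoid are orthonormal in `L²(A, τ)`. -/
theorem map_star_chebTrace_mul_chebTrace (hτ : τ 1 = 1) (hs : ∀ i, IsSemicircular τ (s i))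
    (hG : GIndependentElements τ G s) (p q : Trace G) :
    τ (star (chebTrace hG.commute p) * chebTrace hG.commute q) = if p = q then 1 else 0 := by
  obtain ⟨w, rfl⟩ := p.exists_mk
  induction hn : w.length using Nat.strong_induction_on generalizing w q with
  | _ n ih =>
  have hsa : ∀ i, star (s i) = s i := fun i => (hs i).isSelfAdjoint
  match w with
  | [] =>
    obtain ⟨u, rfl⟩ := q.exists_mk
    rw [chebTrace_mk, chebTrace_mk, chebWord, star_one, one_mul]
    by_cases hu : u = []
    · subst hu
      rw [if_pos rfl, chebWord, hτ]
    · rw [map_chebWord_eq_zero hs hG hu, if_neg]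
      intro h
      have := traceSetoid.length_eq (Trace.mk_eq_mk.1 h)
      exact hu (List.eq_nil_of_length_eq_zero this.symm)
  | i :: w =>
    have hw : w.length < n := by simp [← hn]
    have ih1 : ∀ q, _ := fun q => ih _ hw q w rfl
    -- `τ ((s i * P_w)⋆ * P_q)` is computed by moving `s i` from one side to the other
    have hmove : τ (star (s i * chebTrace hG.commute (Trace.mk w)) * chebTrace hG.commute q) =
        τ (star (chebTrace hG.commute (Trace.mk w)) * (s i * chebTrace hG.commute q)) := by
      rw [star_mul, hsa, mul_assoc]
    by_cases h : G.Leads i w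
    · set v : Trace G := Trace.mk (w.erase i) with hv
      have hwv : (Trace.mk w : Trace G) = v.cons i := (Trace.mk_eq_mk.2 h.cons_erase).symm
      have ih2 : ∀ q, _ := fun q => ih _ (h.length_erase_lt.trans hw) q (w.erase i) rfl
      rw [← Trace.cons_mk]
      rw [hwv] at ih1 hmove ⊢
      rw [chebTrace_cons_cons, star_add, add_mul, map_add, ih2] at hmove
      by_cases hq : ∃ q', Trace.cons i q' = q
      · obtain ⟨q', rfl⟩ := hq
        rw [chebTrace_cons_cons, mul_add, map_add, ih1, ih1] at hmove
        simp only [(Trace.cons_injective i).eq_iff] at hmove ⊢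
        linear_combination hmove
      · push Not at hq
        rw [chebTrace_cons_of_forall_ne _ i q hq, ih1] at hmove
        simp only [(Trace.cons_injective i).eq_iff] at hmove
        rw [if_neg (hq _)]
        linear_combination hmove
    · have hw' : ∀ p, Trace.cons i p ≠ Trace.mk w := fun p hp =>
        h (Trace.exists_cons_eq_mk_iff.1 ⟨p, hp⟩)
      rw [chebTrace_cons_of_forall_ne _ i _ hw', Trace.cons_mk] at hmove
      rw [hmove]
      by_cases hq : ∃ q', Trace.cons i q' = q
      · obtain ⟨q', rfl⟩ := hq
        rw [chebTrace_cons_cons, mul_add, map_add, ih1, ih1, if_neg (hw' _).symm, zero_add,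
          ← Trace.cons_mk]
        simp only [(Trace.cons_injective i).eq_iff]
      · push Not at hq
        rw [chebTrace_cons_of_forall_ne _ i q hq, ih1, if_neg (hw' _).symm, ← Trace.cons_mk,
          if_neg (hq _)]

end Orthonormal

/-! ### Creation and annihilation operators on the Fock space of the trace monoid -/

namespace SimpleGraph

open scoped NNReal ENNReal

variable {V : Type*} [DecidableEq V] {G : SimpleGraph V} {E : Type*}
  [NormedAddCommGroup E]

theorem tsum_extend_cons (i : V) (f : Trace G → E) (g : E → ℝ≥0∞) (h0 : g 0 = 0) :
    ∑' q, g (Function.extend (Trace.cons i) f 0 q) = ∑' p, g (f p) := by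
  rw [← (Trace.cons_injective i).tsum_eq (f := fun q => g (Function.extend (Trace.cons i) f 0 q))]
  · simp only [(Trace.cons_injective i).extend_apply]
  · intro q hq
    by_contra hcon
    refine hq ?_
    simp only
    rw [Function.extend_apply' _ _ _ (by simpa using hcon), Pi.zero_apply, h0]

variable [Fintype V]

/-- Every value of `g` is counted at most `G.cliqueNum` times, once for each letter that divides its
argument from the left. -/
theorem sum_tsum_cons_le (g : Trace G → ℝ≥0∞) :
    ∑ i : V, ∑' q, g (Trace.cons i q) ≤ G.cliqueNum * ∑' q, g q := by
  classical
  have h1 : ∀ i : V, ∑' q, g (Trace.cons i q) =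
      ∑' q, if ∃ p, Trace.cons i p = q then g q else 0 := by
    intro i
    rw [← (Trace.cons_injective i).tsum_eq
      (f := fun q => if ∃ p, Trace.cons i p = q then g q else 0)]
    · exact tsum_congr fun q => by simp
    · intro q hq
      by_contra hcon
      refine hq ?_
      simp only
      rw [if_neg (by simpa using hcon)]
  simp_rw [h1]
  rw [← ENNReal.tsum_mul_left, ← Summable.tsum_finsetSum fun _ _ => ENNReal.summable]
  refine ENNReal.tsum_le_tsum fun q => ?_
  rw [← Finset.sum_filter, Finset.sum_const, nsmul_eq_mul]
  gcongr
  exact Trace.card_left_divisors_le q _ fun i hi => (Finset.mem_filter.1 hi).2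

/-- Cauchy–Schwarz over the letters that divide `q` from the left, of which there are at most
`G.cliqueNum`. -/
theorem nnnorm_sum_creation_sq_le (b : V → E →+ E) (f : Trace G → E) (q : Trace G) :
    ‖∑ i, b i (Function.extend (Trace.cons i) f 0 q)‖₊ ^ 2 ≤
      G.cliqueNum * ∑ i, ‖b i (Function.extend (Trace.cons i) f 0 q)‖₊ ^ 2 := by
  classical
  set x : V → E := fun i => b i (Function.extend (Trace.cons i) f 0 q) with hx
  set D : Finset V := Finset.univ.filter fun i => ∃ p, Trace.cons i p = q with hD
  have hzero : ∀ i, i ∉ D → x i = 0 := by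
    intro i hi
    have hi' : ¬ ∃ p, Trace.cons i p = q := by simpa [hD] using hi
    simp only [hx]
    rw [Function.extend_apply' _ _ _ hi', Pi.zero_apply, map_zero]
  calc ‖∑ i, x i‖₊ ^ 2 = ‖∑ i ∈ D, x i‖₊ ^ 2 := by
        rw [Finset.sum_subset (Finset.subset_univ D) fun i _ hi => hzero i hi]
    _ ≤ (∑ i ∈ D, ‖x i‖₊) ^ 2 := by gcongr; exact nnnorm_sum_le _ _
    _ ≤ D.card * ∑ i ∈ D, ‖x i‖₊ ^ 2 := sq_sum_le_card_mul_sum_sq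
    _ ≤ G.cliqueNum * ∑ i, ‖x i‖₊ ^ 2 := by
        gcongr
        · exact Trace.card_left_divisors_le q D fun i hi => (Finset.mem_filter.1 hi).2
        · exact Finset.subset_univ D

/-- Let `b` be a family of operators with column and row norms at most `√c`. Then the operator
`∑ i, b i ⊗ (ℓ i + (ℓ i)⋆)`, where `ℓ i` is the creation operator of the letter `i`, has norm at
most `2 √(ω c)` on square summable functions on the trace monoid. Creation, `(ℓ i f) q = f (i⁻¹ q)`,
is encoded as `Function.extend (Trace.cons i) f 0`. The two summands have the same bound, and so
`‖x + y‖² ≤ 2 ‖x‖² + 2 ‖y‖²` loses nothing against the triangle inequality. -/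
theorem tsum_enorm_sq_creation_add_annihilation_le (b : V → E →+ E) (c : ℝ≥0)
    (hcol : ∀ x, ∑ i, ‖b i x‖₊ ^ 2 ≤ c * ‖x‖₊ ^ 2)
    (hrow : ∀ x : V → E, ‖∑ i, b i (x i)‖₊ ^ 2 ≤ c * ∑ i, ‖x i‖₊ ^ 2) (f : Trace G → E) :
    ∑' q, ‖∑ i, b i (Function.extend (Trace.cons i) f 0 q + f (Trace.cons i q))‖ₑ ^ 2 ≤
      4 * G.cliqueNum * c * ∑' q, ‖f q‖ₑ ^ 2 := by
  have hpt : ∀ q, ‖∑ i, b i (Function.extend (Trace.cons i) f 0 q + f (Trace.cons i q))‖ₑ ^ 2 ≤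
      2 * (G.cliqueNum * ∑ i, ‖b i (Function.extend (Trace.cons i) f 0 q)‖ₑ ^ 2) +
        2 * (c * ∑ i, ‖f (Trace.cons i q)‖ₑ ^ 2) := by
    intro q
    have h : ‖∑ i, b i (Function.extend (Trace.cons i) f 0 q + f (Trace.cons i q))‖₊ ^ 2 ≤
        2 * (G.cliqueNum * ∑ i, ‖b i (Function.extend (Trace.cons i) f 0 q)‖₊ ^ 2) +
          2 * (c * ∑ i, ‖f (Trace.cons i q)‖₊ ^ 2) := by
      simp only [map_add, Finset.sum_add_distrib]
      calc _ ≤ (‖∑ i, b i (Function.extend (Trace.cons i) f 0 q)‖₊ +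
            ‖∑ i, b i (f (Trace.cons i q))‖₊) ^ 2 := by gcongr; exact nnnorm_add_le _ _
        _ ≤ 2 * (‖∑ i, b i (Function.extend (Trace.cons i) f 0 q)‖₊ ^ 2 +
            ‖∑ i, b i (f (Trace.cons i q))‖₊ ^ 2) := add_sq_le
        _ ≤ _ := by
          rw [mul_add]
          gcongr
          · exact nnnorm_sum_creation_sq_le b f q
          · exact hrow _
    simp only [enorm_eq_nnnorm]
    exact_mod_cast h
  refine (ENNReal.tsum_le_tsum hpt).trans ?_
  rw [ENNReal.tsum_add, ENNReal.tsum_mul_left, ENNReal.tsum_mul_left, ENNReal.tsum_mul_left,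
    ENNReal.tsum_mul_left, Summable.tsum_finsetSum fun _ _ => ENNReal.summable,
    Summable.tsum_finsetSum fun _ _ => ENNReal.summable]
  have h1 : ∑ i, ∑' q, ‖b i (Function.extend (Trace.cons i) f 0 q)‖ₑ ^ 2 ≤
      c * ∑' q, ‖f q‖ₑ ^ 2 := by
    have : ∀ i, ∑' q, ‖b i (Function.extend (Trace.cons i) f 0 q)‖ₑ ^ 2 =
        ∑' q, ‖b i (f q)‖ₑ ^ 2 := fun i =>
      tsum_extend_cons i f (fun x => ‖b i x‖ₑ ^ 2) (by simp)
    simp_rw [this]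
    rw [← Summable.tsum_finsetSum fun _ _ => ENNReal.summable, ← ENNReal.tsum_mul_left]
    refine ENNReal.tsum_le_tsum fun q => ?_
    simp only [enorm_eq_nnnorm]
    exact_mod_cast hcol (f q)
  have h2 := sum_tsum_cons_le fun q => ‖f q‖ₑ ^ 2
  calc _ ≤ 2 * (G.cliqueNum * (c * ∑' q, ‖f q‖ₑ ^ 2)) +
        2 * (c * (G.cliqueNum * ∑' q, ‖f q‖ₑ ^ 2)) := by gcongr
    _ = _ := by ring

end SimpleGraph

/-! ### The action of semicircular matrices on `L²(A, τ)` -/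

section SpanBound

open SimpleGraph
open scoped NNReal ENNReal

variable {L : ℕ} {G : SimpleGraph (Fin L)} {A : Type*} [CStarAlgebra A] {τ : A →ₗ[ℂ] ℂ}
  {s : Fin L → A}

/-- The linear span of the Chebyshev polynomials of a `G`-independent family. -/
noncomputable def chebSpan (hG : GIndependentElements τ G s) : Submodule ℂ A :=
  Submodule.span ℂ (Set.range (chebTrace hG.commute))

theorem one_mem_chebSpan (hG : GIndependentElements τ G s) : 1 ∈ chebSpan hG :=
  Submodule.subset_span ⟨Trace.nil G, chebTrace_nil hG.commute⟩

theorem mul_mem_chebSpan (hG : GIndependentElements τ G s) (i : Fin L) {x : A}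
    (hx : x ∈ chebSpan hG) : s i * x ∈ chebSpan hG := by
  have hmem : ∀ p, chebTrace hG.commute p ∈ chebSpan hG := fun p => Submodule.subset_span ⟨p, rfl⟩
  induction hx using Submodule.span_induction with
  | mem x h =>
    obtain ⟨q, rfl⟩ := h
    by_cases hq : ∃ p, Trace.cons i p = q
    · obtain ⟨p, rfl⟩ := hq
      rw [chebTrace_cons_cons]
      exact add_mem (hmem _) (hmem _)
    · push Not at hq
      rw [chebTrace_cons_of_forall_ne _ i q hq]
      exact hmem _
  | zero => rw [mul_zero]; exact zero_mem _
  | add x y _ _ hx hy => rw [mul_add]; exact add_mem hx hy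
  | smul c x _ hx => rw [mul_smul_comm]; exact Submodule.smul_mem _ c hx

/-- The coefficient of `x` at the trace `q`, in the orthonormal family of Chebyshev polynomials. -/
noncomputable def chebCoeff (hG : GIndependentElements τ G s) (x : A) (q : Trace G) : ℂ :=
  τ (star (chebTrace hG.commute q) * x)

/-- Parseval's identity. -/
theorem tsum_chebCoeff (hτ : IsFaithfulTrace τ) (hs : ∀ i, IsSemicircular τ (s i))
    (hG : GIndependentElements τ G s) {x : A} (hx : x ∈ chebSpan hG) :
    ∑' q, ‖chebCoeff hG x q‖ₑ ^ 2 = ENNReal.ofReal (τ (star x * x)).re := by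
  classical
  obtain ⟨c, rfl⟩ := Finsupp.mem_span_range_iff_exists_finsupp.1 hx
  set x := c.sum fun q a => a • chebTrace hG.commute q with hxdef
  have hc : ∀ q, chebCoeff hG x q = c q := by
    intro q
    rw [chebCoeff, hxdef, Finsupp.sum, Finset.mul_sum, map_sum]
    simp only [mul_smul_comm, map_smul, smul_eq_mul,
      map_star_chebTrace_mul_chebTrace hτ.map_one hs hG]
    simp +contextual
  have hsq : τ (star x * x) = ((∑ q ∈ c.support, ‖c q‖ ^ 2 : ℝ) : ℂ) := by
    conv_lhs => enter [2, 1]; rw [hxdef]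
    rw [Finsupp.sum, star_sum, Finset.sum_mul, map_sum, Complex.ofReal_sum]
    refine Finset.sum_congr rfl fun q _ => ?_
    rw [star_smul, smul_mul_assoc, map_smul, smul_eq_mul]
    change _ * chebCoeff hG x q = _
    rw [hc, Complex.star_def, Complex.conj_mul']
    push_cast
    rfl
  rw [hsq, Complex.ofReal_re, ENNReal.ofReal_sum_of_nonneg fun _ _ => by positivity]
  simp only [hc]
  rw [tsum_eq_sum (s := c.support) fun q hq => by simp [Finsupp.notMem_support_iff.1 hq]]
  refine Finset.sum_congr rfl fun q _ => ?_
  rw [ENNReal.ofReal_pow (norm_nonneg _), ofReal_norm]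

/-- In the orthonormal family of Chebyshev polynomials, `s i` acts as the sum of the creation and
the annihilation operators of the letter `i`. -/
theorem chebCoeff_mul (hs : ∀ i, IsSemicircular τ (s i)) (hG : GIndependentElements τ G s)
    (i : Fin L) (x : A) (q : Trace G) : chebCoeff hG (s i * x) q =
      Function.extend (Trace.cons i) (chebCoeff hG x) 0 q + chebCoeff hG x (Trace.cons i q) := by
  have hmove : chebCoeff hG (s i * x) q = τ (star (s i * chebTrace hG.commute q) * x) := by
    rw [chebCoeff, star_mul, (hs i).isSelfAdjoint.star_eq, mul_assoc]
  rw [hmove]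
  by_cases hq : ∃ p, Trace.cons i p = q
  · obtain ⟨p, rfl⟩ := hq
    rw [chebTrace_cons_cons, star_add, add_mul, map_add, (Trace.cons_injective i).extend_apply,
      add_comm]
    rfl
  · rw [Function.extend_apply' _ _ _ hq]
    push Not at hq
    rw [chebTrace_cons_of_forall_ne _ i q hq, Pi.zero_apply, zero_add]
    rfl

variable {ι : Type*} [Fintype ι] [DecidableEq ι]

/-- Let the operators with matrices `α i` have column and row norms at most `√c`. Then
`∑ i, α i ⊗ s i` has norm at most `2 √(ω c)` on the columns of polynomials in `s`, with respect to
the norm of `L²(A, τ)`. -/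
theorem sum_map_star_mul_le (hτ : IsFaithfulTrace τ) (hs : ∀ i, IsSemicircular τ (s i))
    (hG : GIndependentElements τ G s) (α : Fin L → Matrix ι ι ℂ) (c : ℝ≥0)
    (hcol : ∀ x, ∑ i, ‖(α i).toEuclideanLin x‖₊ ^ 2 ≤ c * ‖x‖₊ ^ 2)
    (hrow : ∀ x : Fin L → EuclideanSpace ℂ ι,
      ‖∑ i, (α i).toEuclideanLin (x i)‖₊ ^ 2 ≤ c * ∑ i, ‖x i‖₊ ^ 2)
    (ξ : ι → A) (hξ : ∀ k, ξ k ∈ chebSpan hG) :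
    ∑ k, (τ (star (∑ l, (∑ i, α i k l • s i) * ξ l) * ∑ l, (∑ i, α i k l • s i) * ξ l)).re ≤
      4 * G.cliqueNum * c * ∑ k, (τ (star (ξ k) * ξ k)).re := by
  set η : ι → A := fun k => ∑ l, (∑ i, α i k l • s i) * ξ l with hη
  have hηmem : ∀ k, η k ∈ chebSpan hG := fun k => by
    refine sum_mem fun l _ => ?_
    rw [Finset.sum_mul]
    refine sum_mem fun i _ => ?_
    rw [smul_mul_assoc]
    exact Submodule.smul_mem _ _ (mul_mem_chebSpan hG i (hξ l))
  set F : (ι → A) → Trace G → EuclideanSpace ℂ ι :=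
    fun ζ q => WithLp.toLp 2 fun k => chebCoeff hG (ζ k) q with hF
  have hnonneg : ∀ x : A, 0 ≤ (τ (star x * x)).re := fun x => (Complex.le_def.1 (hτ.nonneg x)).1
  have hnorm : ∀ ζ : ι → A, (∀ k, ζ k ∈ chebSpan hG) →
      ∑' q, ‖F ζ q‖ₑ ^ 2 = ENNReal.ofReal (∑ k, (τ (star (ζ k) * ζ k)).re) := by
    intro ζ hζ
    have h1 : ∀ q, ‖F ζ q‖ₑ ^ 2 = ∑ k, ‖chebCoeff hG (ζ k) q‖ₑ ^ 2 := by
      intro q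
      have : ‖F ζ q‖₊ ^ 2 = ∑ k, ‖chebCoeff hG (ζ k) q‖₊ ^ 2 := by
        rw [← NNReal.coe_inj]
        push_cast
        exact EuclideanSpace.norm_sq_eq _
      simp only [enorm_eq_nnnorm]
      exact_mod_cast this
    simp_rw [h1]
    rw [Summable.tsum_finsetSum fun _ _ => ENNReal.summable,
      ENNReal.ofReal_sum_of_nonneg fun k _ => hnonneg _]
    exact Finset.sum_congr rfl fun k _ => tsum_chebCoeff hτ hs hG (hζ k)
  have hshift : ∀ q, F η q = ∑ i, (α i).toEuclideanLin
      (Function.extend (Trace.cons i) (F ξ) 0 q + F ξ (Trace.cons i q)) := by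
    intro q
    have hext : ∀ i l, Function.extend (Trace.cons i) (F ξ) 0 q l =
        Function.extend (Trace.cons i) (chebCoeff hG (ξ l)) 0 q := by
      intro i l
      by_cases hq : ∃ p, Trace.cons i p = q
      · obtain ⟨p, rfl⟩ := hq
        rw [(Trace.cons_injective i).extend_apply, (Trace.cons_injective i).extend_apply]
      · rw [Function.extend_apply' _ _ _ hq, Function.extend_apply' _ _ _ hq]
        rfl
    ext k
    have hcoeff : ∀ l, chebCoeff hG ((∑ i, α i k l • s i) * ξ l) q =
        ∑ i, α i k l * chebCoeff hG (s i * ξ l) q := by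
      intro l
      simp only [chebCoeff, Finset.sum_mul, Finset.mul_sum, map_sum, smul_mul_assoc,
        mul_smul_comm, map_smul, smul_eq_mul]
    have hsum : chebCoeff hG (η k) q = ∑ l, chebCoeff hG ((∑ i, α i k l • s i) * ξ l) q := by
      simp only [chebCoeff, hη, Finset.mul_sum, map_sum]
    change chebCoeff hG (η k) q = _
    rw [hsum]
    simp only [hcoeff, chebCoeff_mul hs]
    rw [Finset.sum_comm, WithLp.ofLp_sum, Finset.sum_apply]
    refine Finset.sum_congr rfl fun i _ => ?_
    rw [Matrix.ofLp_toLpLin, Matrix.toLin'_apply, Matrix.mulVec, dotProduct]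
    refine Finset.sum_congr rfl fun l _ => ?_
    rw [PiLp.add_apply, hext]
  have hmain := tsum_enorm_sq_creation_add_annihilation_le (G := G)
    (fun i => (α i).toEuclideanLin.toAddMonoidHom) c hcol hrow (F ξ)
  change ∑' q, ‖∑ i, (α i).toEuclideanLin _‖ₑ ^ 2 ≤ _ at hmain
  simp_rw [← hshift] at hmain
  rw [hnorm η hηmem, hnorm ξ hξ] at hmain
  have hconst : (4 * G.cliqueNum * c : ℝ≥0∞) = ENNReal.ofReal (4 * G.cliqueNum * c) := by
    rw [ENNReal.ofReal_mul (by positivity), ENNReal.ofReal_mul (by positivity)]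
    simp
  rw [hconst, ← ENNReal.ofReal_mul (by positivity)] at hmain
  exact (ENNReal.ofReal_le_ofReal_iff
    (mul_nonneg (by positivity) (Finset.sum_nonneg fun k _ => hnonneg _))).1 hmain

end SpanBound

/-! ### Norms and moments with respect to a faithful functional -/

section Moments

open Filter Topology

variable {B : Type*} [CStarAlgebra B]

/-- If `φ` is a faithful positive functional, then the growth of the moments of a self-adjoint
element bounds its norm: a continuous function `g` that vanishes on `[-d, d]` with `D < d` satisfies
`g (x) ^ 2 ≤ (x / d) ^ (2 m)` for all `m`, and so `φ (g (T) ^ 2) = 0`. -/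
theorem IsSelfAdjoint.norm_le_of_moments_le (φ : B →ₗ[ℂ] ℂ) (hpos : ∀ a, 0 ≤ φ (star a * a))
    (hfaith : ∀ a, φ (star a * a) = 0 → a = 0) {T : B} (hT : IsSelfAdjoint T) {D K : ℝ}
    (hD : 0 ≤ D) (h : ∀ m : ℕ, (φ (star (T ^ m) * T ^ m)).re ≤ K * D ^ (2 * m)) : ‖T‖ ≤ D := by
  by_contra! hlt
  obtain ⟨d, hDd, hdT⟩ := exists_between hlt
  have hd0 : 0 < d := hD.trans_lt hDd
  set g : ℝ → ℝ := fun x => min 1 (max 0 (|x| - d)) with hg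
  have hgc : Continuous g := by fun_prop
  have hgle : ∀ (m : ℕ) (x : ℝ), 0 ≤ (d ^ (2 * m))⁻¹ * (x ^ m * x ^ m) - g x * g x := by
    intro m x
    have hsq : (d ^ (2 * m))⁻¹ * (x ^ m * x ^ m) = ((|x| / d) ^ m) ^ 2 := by
      rw [← pow_mul, div_pow, mul_comm m 2, pow_mul |x|, sq_abs, ← pow_mul, two_mul, pow_add x]
      field_simp
    rw [hsq, sub_nonneg]
    by_cases hx : |x| ≤ d
    · have : g x = 0 := by simp [hg, hx]
      rw [this, mul_zero]
      positivity
    · push Not at hx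
      have h0 : 0 ≤ g x := by simp [hg]
      have h1 : g x ≤ 1 := by simp [hg]
      have h2 : 1 ≤ (|x| / d) ^ m := one_le_pow₀ ((one_le_div hd0).2 hx.le)
      nlinarith
  have hstar : ∀ f : ℝ → ℝ, star (cfc f T) = cfc f T := fun f => (cfc_predicate f T).star_eq
  have hbound : ∀ m : ℕ, (φ (star (cfc g T) * cfc g T)).re ≤ K * ((D / d) ^ 2) ^ m := by
    intro m
    set f : ℝ → ℝ := fun x => (d ^ (2 * m))⁻¹ * (x ^ m * x ^ m) - g x * g x with hf
    have hroot : star (cfc (fun x => √(f x)) T) * cfc (fun x => √(f x)) T =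
        ((d ^ (2 * m))⁻¹ : ℝ) • (star (T ^ m) * T ^ m) - star (cfc g T) * cfc g T := by
      rw [hstar, hstar, ← cfc_mul (fun x => √(f x)) (fun x => √(f x)) T, star_pow, hT.star_eq]
      simp only [Real.mul_self_sqrt (hgle m _), hf]
      rw [cfc_sub _ _ T, cfc_const_mul _ _ T, cfc_mul _ _ T, cfc_mul _ _ T, cfc_pow_id T m]
    have h0 := (Complex.le_def.1 (hpos (cfc (fun x => √(f x)) T))).1
    rw [hroot, map_sub, Complex.sub_re, ← Complex.coe_smul, map_smul, smul_eq_mul,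
      Complex.re_ofReal_mul, Complex.zero_re, sub_nonneg] at h0
    refine h0.trans ?_
    calc (d ^ (2 * m))⁻¹ * (φ (star (T ^ m) * T ^ m)).re
        ≤ (d ^ (2 * m))⁻¹ * (K * D ^ (2 * m)) := by gcongr; exact h m
      _ = K * ((D / d) ^ 2) ^ m := by
        rw [← pow_mul, div_pow]
        field_simp
  have hlim : Tendsto (fun m : ℕ => K * ((D / d) ^ 2) ^ m) atTop (𝓝 (K * 0)) := by
    refine (tendsto_pow_atTop_nhds_zero_of_lt_one (by positivity) ?_).const_mul K
    exact pow_lt_one₀ (by positivity) ((div_lt_one hd0).2 hDd) two_ne_zero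
  have hle : (φ (star (cfc g T) * cfc g T)).re ≤ 0 := by
    simpa using ge_of_tendsto' hlim hbound
  have hzero : cfc g T = 0 := by
    refine hfaith _ (Complex.ext ?_ ?_)
    · exact le_antisymm hle (Complex.le_def.1 (hpos _)).1
    · exact (Complex.le_def.1 (hpos _)).2.symm
  have hgzero : ∀ x ∈ spectrum ℝ T, ‖g x‖ ≤ 0 :=
    (norm_cfc_le_iff g T le_rfl).1 (by rw [hzero, norm_zero])
  have hspec : ∀ x ∈ spectrum ℝ T, ‖x‖ ≤ d := by
    intro x hx
    have hx0 := norm_le_zero_iff.1 (hgzero x hx)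
    by_contra! hcon
    have : 0 < g x := by
      simp only [hg]
      exact lt_min one_pos (lt_max_of_lt_right (sub_pos.2 hcon))
    exact this.ne' hx0
  have hnorm : ‖cfc (fun x : ℝ => x) T‖ ≤ d := norm_cfc_le hd0.le hspec
  rw [cfc_id' ℝ T] at hnorm
  linarith

end Moments

/-! ### Norms of matrices with semicircular entries -/

section MatrixNorm

open scoped NNReal

variable {L : ℕ} {G : SimpleGraph (Fin L)} {A : Type*} [CStarAlgebra A] {τ : A →ₗ[ℂ] ℂ}
  {s : Fin L → A} {ι : Type*}

/-- The matrix `∑ i, α i ⊗ s i` with entries in `A`. -/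
noncomputable def semicircularMatrix (s : Fin L → A) (α : Fin L → Matrix ι ι ℂ) :
    CStarMatrix ι ι A :=
  CStarMatrix.ofMatrix (Matrix.of fun k l => ∑ i, α i k l • s i)

theorem semicircularMatrix_apply (α : Fin L → Matrix ι ι ℂ) (k l : ι) :
    semicircularMatrix s α k l = ∑ i, α i k l • s i := rfl

theorem star_semicircularMatrix (hs : ∀ i, IsSelfAdjoint (s i)) (α : Fin L → Matrix ι ι ℂ) :
    star (semicircularMatrix s α) = semicircularMatrix s fun i => (α i).conjTranspose := by
  ext k l
  simp [CStarMatrix.star_apply, semicircularMatrix_apply, star_sum, (hs _).star_eq]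

/-- The functional `Tr ⊗ τ` on matrices. -/
noncomputable def matrixTrace (ι : Type*) [Fintype ι] (τ : A →ₗ[ℂ] ℂ) :
    CStarMatrix ι ι A →ₗ[ℂ] ℂ where
  toFun X := ∑ k, τ (X k k)
  map_add' X Y := by simp [Finset.sum_add_distrib]
  map_smul' c X := by simp [Finset.mul_sum]

theorem matrixTrace_star_mul [Fintype ι] (X : CStarMatrix ι ι A) :
    matrixTrace ι τ (star X * X) = ∑ l, ∑ k, τ (star (X k l) * X k l) := by
  simp [matrixTrace, CStarMatrix.mul_apply, CStarMatrix.star_apply]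

/-- The growth of the moments of `star Y * Y`, where `Y = ∑ i, α i ⊗ s i`, is controlled by the
bound on `L²(A, τ)`, and the faithfulness of `Tr ⊗ τ` turns this into a bound for the C⋆-norm. -/
theorem norm_semicircularMatrix_le [Fintype ι] [DecidableEq ι] [PartialOrder A] [StarOrderedRing A]
    (hτ : IsFaithfulTrace τ) (hs : ∀ i, IsSemicircular τ (s i)) (hG : GIndependentElements τ G s)
    (α : Fin L → Matrix ι ι ℂ) (c : ℝ≥0)
    (hcol : ∀ x, ∑ i, ‖(α i).toEuclideanLin x‖₊ ^ 2 ≤ c * ‖x‖₊ ^ 2)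
    (hrow : ∀ x : Fin L → EuclideanSpace ℂ ι,
      ‖∑ i, (α i).toEuclideanLin (x i)‖₊ ^ 2 ≤ c * ∑ i, ‖x i‖₊ ^ 2)
    (hcol' : ∀ x, ∑ i, ‖(α i).conjTranspose.toEuclideanLin x‖₊ ^ 2 ≤ c * ‖x‖₊ ^ 2)
    (hrow' : ∀ x : Fin L → EuclideanSpace ℂ ι,
      ‖∑ i, (α i).conjTranspose.toEuclideanLin (x i)‖₊ ^ 2 ≤ c * ∑ i, ‖x i‖₊ ^ 2) :
    ‖semicircularMatrix s α‖ ^ 2 ≤ 4 * G.cliqueNum * c := by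
  set Y := semicircularMatrix s α with hY
  set D : ℝ := 4 * G.cliqueNum * c with hD
  have hD0 : 0 ≤ D := by positivity
  -- one multiplication by a semicircular matrix preserves polynomial entries and gains a factor `D`
  have hstep : ∀ (β : Fin L → Matrix ι ι ℂ),
      (∀ x, ∑ i, ‖(β i).toEuclideanLin x‖₊ ^ 2 ≤ c * ‖x‖₊ ^ 2) →
      (∀ x : Fin L → EuclideanSpace ℂ ι,
        ‖∑ i, (β i).toEuclideanLin (x i)‖₊ ^ 2 ≤ c * ∑ i, ‖x i‖₊ ^ 2) →
      ∀ X : CStarMatrix ι ι A, (∀ k l, X k l ∈ chebSpan hG) →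
        (∀ k l, (semicircularMatrix s β * X) k l ∈ chebSpan hG) ∧
        (matrixTrace ι τ (star (semicircularMatrix s β * X) * (semicircularMatrix s β * X))).re ≤
          D * (matrixTrace ι τ (star X * X)).re := by
    intro β hβ hβ' X hX
    constructor
    · intro k l
      rw [CStarMatrix.mul_apply]
      refine sum_mem fun j _ => ?_
      rw [semicircularMatrix_apply, Finset.sum_mul]
      refine sum_mem fun i _ => ?_
      rw [smul_mul_assoc]
      exact Submodule.smul_mem _ _ (mul_mem_chebSpan hG i (hX j l))
    · rw [matrixTrace_star_mul, matrixTrace_star_mul, Complex.re_sum, Complex.re_sum,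
        Finset.mul_sum]
      refine Finset.sum_le_sum fun l _ => ?_
      rw [Complex.re_sum, Complex.re_sum]
      simp only [CStarMatrix.mul_apply, semicircularMatrix_apply]
      exact sum_map_star_mul_le hτ hs hG β c hβ hβ' (fun k => X k l) fun k => hX k l
  have hpos : ∀ X : CStarMatrix ι ι A, 0 ≤ matrixTrace ι τ (star X * X) := fun X => by
    rw [matrixTrace_star_mul]
    exact Finset.sum_nonneg fun l _ => Finset.sum_nonneg fun k _ => hτ.nonneg _
  have hfaith : ∀ X : CStarMatrix ι ι A, matrixTrace ι τ (star X * X) = 0 → X = 0 := by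
    intro X hX
    rw [matrixTrace_star_mul, Finset.sum_eq_zero_iff_of_nonneg
      fun l _ => Finset.sum_nonneg fun k _ => hτ.nonneg _] at hX
    ext k l
    have := (Finset.sum_eq_zero_iff_of_nonneg fun k _ => hτ.nonneg _).1 (hX l (Finset.mem_univ l))
      k (Finset.mem_univ k)
    exact hτ.faithful _ this
  have hpow : ∀ m : ℕ, (∀ k l, ((star Y * Y) ^ m) k l ∈ chebSpan hG) ∧
      (matrixTrace ι τ (star ((star Y * Y) ^ m) * (star Y * Y) ^ m)).re ≤
        (matrixTrace ι τ (star (1 : CStarMatrix ι ι A) * 1)).re * D ^ (2 * m) := by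
    intro m
    induction m with
    | zero =>
      refine ⟨fun k l => ?_, by simp⟩
      rw [pow_zero, CStarMatrix.one_apply]
      split_ifs
      · exact one_mem_chebSpan hG
      · exact zero_mem _
    | succ m ih =>
      obtain ⟨h1, h2⟩ := hstep α hcol hrow _ ih.1
      obtain ⟨h3, h4⟩ := hstep _ hcol' hrow' _ h1
      have hsucc : star Y * (Y * (star Y * Y) ^ m) = (star Y * Y) ^ (m + 1) := by
        rw [← mul_assoc, ← pow_succ']
      rw [← star_semicircularMatrix (fun i => (hs i).isSelfAdjoint), ← hY, hsucc] at h3 h4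
      refine ⟨h3, h4.trans ?_⟩
      calc _ ≤ D * (D * ((matrixTrace ι τ (star (1 : CStarMatrix ι ι A) * 1)).re *
            D ^ (2 * m))) := by
            gcongr
            refine h2.trans ?_
            gcongr
            exact ih.2
        _ = _ := by ring
  have := (IsSelfAdjoint.star_mul_self Y).norm_le_of_moments_le (matrixTrace ι τ) hpos hfaith hD0
    fun m => (hpow m).2
  rwa [CStarRing.norm_star_mul_self, ← sq] at this

end MatrixNorm

/-! ### Amplification of representations to matrices -/

section Amplification

variable {A : Type*} [CStarAlgebra A] {K : Type*} [NormedAddCommGroup K] [InnerProductSpace ℂ K]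
  [CompleteSpace K] {ι : Type*} [Fintype ι] [DecidableEq ι]

/-- The action of a matrix with entries in `A` on the Hilbert space `K ^ ι`, by means of a
representation of `A` on `K`. -/
noncomputable def amplifyApply (ρ : A →⋆ₐ[ℂ] (K →L[ℂ] K)) (X : CStarMatrix ι ι A) :
    PiLp 2 (fun _ : ι => K) →L[ℂ] PiLp 2 (fun _ : ι => K) :=
  (PiLp.continuousLinearEquiv 2 ℂ fun _ : ι => K).symm.toContinuousLinearMap ∘L
    ContinuousLinearMap.pi fun k => ∑ l, ρ (X k l) ∘L PiLp.proj 2 (fun _ : ι => K) l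

omit [DecidableEq ι] in
theorem amplifyApply_apply (ρ : A →⋆ₐ[ℂ] (K →L[ℂ] K)) (X : CStarMatrix ι ι A)
    (z : PiLp 2 fun _ : ι => K) (k : ι) : amplifyApply ρ X z k = ∑ l, ρ (X k l) (z l) := by
  simp [amplifyApply]

/-- The amplification of a representation of `A` to matrices with entries in `A`. -/
noncomputable def amplify (ρ : A →⋆ₐ[ℂ] (K →L[ℂ] K)) :
    CStarMatrix ι ι A →⋆ₐ[ℂ] (PiLp 2 (fun _ : ι => K) →L[ℂ] PiLp 2 (fun _ : ι => K)) where
  toFun := amplifyApply ρ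
  map_one' := by
    ext z k
    simp only [amplifyApply_apply, CStarMatrix.one_apply]
    rw [Finset.sum_eq_single k (fun l _ hl => by simp [hl.symm]) (by simp)]
    simp
  map_mul' X Y := by
    ext z k
    simp only [amplifyApply_apply, mul_apply_eq_comp, CStarMatrix.mul_apply, map_sum,
      map_mul, sum_apply]
    exact Finset.sum_comm
  map_zero' := by
    ext z k
    simp [amplifyApply_apply]
  map_add' X Y := by
    ext z k
    simp [amplifyApply_apply, Finset.sum_add_distrib]
  commutes' c := by
    ext z k
    simp only [amplifyApply_apply, CStarMatrix.algebraMap_apply]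
    rw [Finset.sum_eq_single k (fun l _ hl => by simp [hl.symm]) (by simp)]
    simp [Algebra.algebraMap_eq_smul_one]
  map_star' X := by
    rw [ContinuousLinearMap.star_eq_adjoint, ContinuousLinearMap.eq_adjoint_iff]
    intro x y
    simp only [PiLp.inner_apply, amplifyApply_apply, CStarMatrix.star_apply, map_star, sum_inner,
      inner_sum, ContinuousLinearMap.star_eq_adjoint, ContinuousLinearMap.adjoint_inner_left]
    exact Finset.sum_comm

/-- The amplification of a representation is contractive, here expressed by its matrix
coefficients. -/
theorem norm_sum_inner_le [PartialOrder A] [StarOrderedRing A] (ρ : A →⋆ₐ[ℂ] (K →L[ℂ] K))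
    (X : CStarMatrix ι ι A) (y z : ι → K) :
    ‖∑ k, ∑ l, inner ℂ (y k) (ρ (X k l) (z l))‖ ≤
      ‖X‖ * √(∑ k, ‖y k‖ ^ 2) * √(∑ k, ‖z k‖ ^ 2) := by
  have h : ∑ k, ∑ l, inner ℂ (y k) (ρ (X k l) (z l)) =
      inner ℂ (WithLp.toLp 2 y) (amplify ρ X (WithLp.toLp 2 z)) := by
    simp only [PiLp.inner_apply, ← inner_sum]
    exact Finset.sum_congr rfl fun k _ => congrArg _ (amplifyApply_apply ρ X _ k).symm
  have hn : ∀ x : ι → K, ‖(WithLp.toLp 2 x : PiLp 2 fun _ : ι => K)‖ = √(∑ k, ‖x k‖ ^ 2) :=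
    fun x => PiLp.norm_eq_of_L2 _
  rw [h, ← hn, ← hn]
  refine (norm_inner_le_norm _ _).trans ?_
  have h1 := (amplify ρ X).le_opNorm (WithLp.toLp 2 z)
  have h2 : ‖amplify ρ X‖ ≤ ‖X‖ := NonUnitalStarAlgHom.norm_apply_le (amplify ρ) X
  calc _ ≤ ‖(WithLp.toLp 2 y : PiLp 2 fun _ : ι => K)‖ *
        (‖X‖ * ‖(WithLp.toLp 2 z : PiLp 2 fun _ : ι => K)‖) := by
        gcongr
        exact h1.trans (by gcongr)
    _ = _ := by ring

end Amplification

/-! ### Column and row bounds for operators and their compressions -/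

section RowColumn

variable {H : Type*} [NormedAddCommGroup H] [InnerProductSpace ℂ H] [CompleteSpace H]
  {κ : Type*} [Fintype κ]

/-- The norm of the column with entries `T i`. -/
theorem sum_norm_apply_sq_le (T : κ → H →L[ℂ] H) (v : H) :
    ∑ i, ‖T i v‖ ^ 2 ≤ ‖∑ i, star (T i) * T i‖ * ‖v‖ ^ 2 := by
  have h : ((∑ i, ‖T i v‖ ^ 2 : ℝ) : ℂ) = inner ℂ v ((∑ i, star (T i) * T i) v) := by
    rw [sum_apply, inner_sum, Complex.ofReal_sum]
    refine Finset.sum_congr rfl fun i _ => ?_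
    rw [mul_apply_eq_comp, ContinuousLinearMap.star_eq_adjoint,
      ContinuousLinearMap.adjoint_inner_right, inner_self_eq_norm_sq_to_K]
    simp
  have h2 := norm_inner_le_norm (𝕜 := ℂ) v ((∑ i, star (T i) * T i) v)
  rw [← h, Complex.norm_real, Real.norm_of_nonneg (by positivity)] at h2
  calc _ ≤ ‖v‖ * (‖∑ i, star (T i) * T i‖ * ‖v‖) := h2.trans (by
        gcongr; exact ContinuousLinearMap.le_opNorm _ _)
    _ = _ := by ring

/-- The norm of the row with entries `T i`. -/
theorem norm_sum_apply_sq_le (T : κ → H →L[ℂ] H) (v : κ → H) :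
    ‖∑ i, T i (v i)‖ ^ 2 ≤ ‖∑ i, T i * star (T i)‖ * ∑ i, ‖v i‖ ^ 2 := by
  set y := ∑ i, T i (v i) with hy
  have h1 : ‖y‖ ^ 2 ≤ ∑ i, ‖star (T i) y‖ * ‖v i‖ := by
    have : ((‖y‖ ^ 2 : ℝ) : ℂ) = ∑ i, inner ℂ (star (T i) y) (v i) := by
      have h0 : inner ℂ y y = ((‖y‖ ^ 2 : ℝ) : ℂ) := by
        rw [inner_self_eq_norm_sq_to_K]
        simp
      rw [← h0]
      conv_lhs => enter [3]; rw [hy]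
      rw [inner_sum]
      refine Finset.sum_congr rfl fun i _ => ?_
      rw [ContinuousLinearMap.star_eq_adjoint, ContinuousLinearMap.adjoint_inner_left]
    have h2 := congrArg norm this
    rw [Complex.norm_real, Real.norm_of_nonneg (by positivity)] at h2
    rw [h2]
    exact (norm_sum_le _ _).trans (Finset.sum_le_sum fun i _ => norm_inner_le_norm _ _)
  have h2 := Finset.sum_mul_sq_le_sq_mul_sq Finset.univ (fun i => ‖star (T i) y‖) fun i => ‖v i‖
  have h3 := sum_norm_apply_sq_le (fun i => star (T i)) y
  simp only [star_star] at h3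
  by_cases hy0 : ‖y‖ ^ 2 = 0
  · rw [hy0]
    positivity
  have hpos : 0 < ‖y‖ ^ 2 := lt_of_le_of_ne (by positivity) (Ne.symm hy0)
  refine le_of_mul_le_mul_left ?_ hpos
  calc ‖y‖ ^ 2 * ‖y‖ ^ 2 = (‖y‖ ^ 2) ^ 2 := by ring
    _ ≤ (∑ i, ‖star (T i) y‖ * ‖v i‖) ^ 2 := by gcongr
    _ ≤ (∑ i, ‖star (T i) y‖ ^ 2) * ∑ i, ‖v i‖ ^ 2 := h2
    _ ≤ (‖∑ i, T i * star (T i)‖ * ‖y‖ ^ 2) * ∑ i, ‖v i‖ ^ 2 := by gcongr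
    _ = _ := by ring

variable {ι : Type*} [Fintype ι]

/-- The matrix of the compression of `T` to the span of the vectors `e k`. -/
noncomputable def compressionMatrix (e : ι → H) (T : H →L[ℂ] H) : Matrix ι ι ℂ :=
  Matrix.of fun k l => inner ℂ (e k) (T (e l))

omit [Fintype ι] in
theorem compressionMatrix_conjTranspose (e : ι → H) (T : H →L[ℂ] H) :
    (compressionMatrix e T).conjTranspose = compressionMatrix e (star T) := by
  ext k l
  simp only [compressionMatrix, Matrix.conjTranspose_apply, Matrix.of_apply,
    ContinuousLinearMap.star_eq_adjoint, ContinuousLinearMap.adjoint_inner_right]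
  exact inner_conj_symm _ _

variable [DecidableEq ι]

omit [CompleteSpace H] in
theorem compressionMatrix_toEuclideanLin_apply (e : ι → H) (T : H →L[ℂ] H)
    (x : EuclideanSpace ℂ ι) (k : ι) :
    (compressionMatrix e T).toEuclideanLin x k = inner ℂ (e k) (T (∑ l, x l • e l)) := by
  rw [Matrix.ofLp_toLpLin, Matrix.toLin'_apply, Matrix.mulVec, dotProduct, map_sum, inner_sum]
  refine Finset.sum_congr rfl fun l _ => ?_
  rw [map_smul, inner_smul_right, mul_comm]
  rfl

omit [CompleteSpace H] [DecidableEq ι] in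
theorem Orthonormal.norm_sum_smul_sq {e : ι → H} (he : Orthonormal ℂ e) (x : EuclideanSpace ℂ ι) :
    ‖∑ l, x l • e l‖ ^ 2 = ‖x‖ ^ 2 := by
  have h : ((‖∑ l, x l • e l‖ ^ 2 : ℝ) : ℂ) = ((‖x‖ ^ 2 : ℝ) : ℂ) := by
    have h1 := he.inner_sum (fun l => x l) (fun l => x l) Finset.univ
    rw [inner_self_eq_norm_sq_to_K] at h1
    rw [EuclideanSpace.norm_sq_eq]
    push_cast
    refine (by simpa using h1 : _ = _).trans (Finset.sum_congr rfl fun l _ => ?_)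
    exact Complex.conj_mul' _
  exact_mod_cast h

omit [CompleteSpace H] [DecidableEq ι] in
/-- Bessel's inequality. -/
theorem Orthonormal.norm_toLp_inner_sq_le {e : ι → H} (he : Orthonormal ℂ e) (v : H) :
    ‖(WithLp.toLp 2 fun k => inner ℂ (e k) v : EuclideanSpace ℂ ι)‖ ^ 2 ≤ ‖v‖ ^ 2 := by
  rw [EuclideanSpace.norm_sq_eq]
  exact he.sum_inner_products_le v (s := Finset.univ)

theorem Orthonormal.sum_norm_compressionMatrix_sq_le {e : ι → H} (he : Orthonormal ℂ e)
    (T : κ → H →L[ℂ] H) (x : EuclideanSpace ℂ ι) :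
    ∑ i, ‖(compressionMatrix e (T i)).toEuclideanLin x‖ ^ 2 ≤
      ‖∑ i, star (T i) * T i‖ * ‖x‖ ^ 2 := by
  rw [← he.norm_sum_smul_sq x]
  refine le_trans (Finset.sum_le_sum fun i _ => ?_) (sum_norm_apply_sq_le T _)
  refine le_trans (le_of_eq ?_) (he.norm_toLp_inner_sq_le _)
  congr 2
  ext k
  exact compressionMatrix_toEuclideanLin_apply e (T i) x k

theorem Orthonormal.norm_sum_compressionMatrix_sq_le {e : ι → H} (he : Orthonormal ℂ e)
    (T : κ → H →L[ℂ] H) (x : κ → EuclideanSpace ℂ ι) :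
    ‖∑ i, (compressionMatrix e (T i)).toEuclideanLin (x i)‖ ^ 2 ≤
      ‖∑ i, T i * star (T i)‖ * ∑ i, ‖x i‖ ^ 2 := by
  have hx : ∑ i, ‖x i‖ ^ 2 = ∑ i, ‖∑ l, x i l • e l‖ ^ 2 :=
    Finset.sum_congr rfl fun i _ => (he.norm_sum_smul_sq (x i)).symm
  rw [hx]
  refine le_trans (le_of_eq ?_) ((he.norm_toLp_inner_sq_le (∑ i, T i (∑ l, x i l • e l))).trans
    (norm_sum_apply_sq_le T _))
  congr 2
  ext k
  rw [WithLp.ofLp_sum, Finset.sum_apply]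
  simp only [compressionMatrix_toEuclideanLin_apply, inner_sum]

end RowColumn

/-! ### The spatial tensor product -/

section Tensor

variable {H : Type*} [NormedAddCommGroup H] [InnerProductSpace ℂ H]
  {K : Type*} [NormedAddCommGroup K] [InnerProductSpace ℂ K]

/-- Two vectors of `H ⊗ K` have expansions along a common finite orthonormal family of `H`. -/
theorem exists_orthonormal_sum_tmul (y z : H ⊗[ℂ] K) :
    ∃ (n : ℕ) (e : Fin n → H) (_ : Orthonormal ℂ e) (y' z' : Fin n → K),
      y = ∑ k, e k ⊗ₜ[ℂ] y' k ∧ z = ∑ k, e k ⊗ₜ[ℂ] z' k := by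
  obtain ⟨E, hE, hyz⟩ :=
    TensorProduct.exists_finite_submodule_left_of_setFinite ({y, z} : Set (H ⊗[ℂ] K))
      (Set.toFinite _)
  have : FiniteDimensional ℂ E := hE
  let b := stdOrthonormalBasis ℂ E
  have hexp : ∀ x ∈ ({y, z} : Set (H ⊗[ℂ] K)), ∃ x' : Fin (Module.finrank ℂ E) → K,
      x = ∑ k, (b k : H) ⊗ₜ[ℂ] x' k := by
    intro x hx
    obtain ⟨w, rfl⟩ := hyz hx
    obtain ⟨c, rfl⟩ := TensorProduct.eq_repr_basis_left b.toBasis w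
    refine ⟨c, ?_⟩
    rw [Finsupp.sum_fintype _ _ (by simp), map_sum]
    simp
  obtain ⟨y', hy⟩ := hexp y (by simp)
  obtain ⟨z', hz⟩ := hexp z (by simp)
  exact ⟨_, fun k => b k, b.orthonormal.comp_linearIsometry E.subtypeₗᵢ, y', z', hy, hz⟩

theorem Orthonormal.norm_sum_tmul {n : ℕ} {e : Fin n → H} (he : Orthonormal ℂ e) (z : Fin n → K) :
    ‖∑ k, e k ⊗ₜ[ℂ] z k‖ = √(∑ k, ‖z k‖ ^ 2) := by
  classical
  rw [eq_comm, Real.sqrt_eq_iff_eq_sq (by positivity) (norm_nonneg _)]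
  have h : inner ℂ (∑ k, e k ⊗ₜ[ℂ] z k) (∑ k, e k ⊗ₜ[ℂ] z k) = ∑ k, inner ℂ (z k) (z k) := by
    simp only [sum_inner, inner_sum, TensorProduct.inner_tmul, orthonormal_iff_ite.1 he]
    simp
  have hz : ∀ k, inner ℂ (z k) (z k) = ((‖z k‖ ^ 2 : ℝ) : ℂ) := fun k => by
    rw [inner_self_eq_norm_sq_to_K]
    simp
  rw [Finset.sum_congr rfl fun k _ => hz k] at h
  have h' := h.symm.trans (inner_self_eq_norm_sq_to_K (𝕜 := ℂ) (∑ k, e k ⊗ₜ[ℂ] z k))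
  rw [← Complex.ofReal_sum] at h'
  exact Complex.ofReal_injective (h'.trans (Complex.ofReal_pow _ 2).symm)

variable [CompleteSpace K] {A : Type*} [CStarAlgebra A] {L : ℕ}

/-- The norm of `∑ i, T i ⊗ ρ (s i)` is controlled by the norms of the matrices with entries in `A`
that are obtained by compressing the operators `T i` to finite-dimensional subspaces. -/
theorem opNorm_le_of_forall_compression [PartialOrder A] [StarOrderedRing A]
    (ρ : A →⋆ₐ[ℂ] (K →L[ℂ] K)) (T : Fin L → H →L[ℂ] H) (s : Fin L → A) {C : ℝ} (hC : 0 ≤ C)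
    (h : ∀ (n : ℕ) (e : Fin n → H), Orthonormal ℂ e →
      ‖semicircularMatrix s fun i => compressionMatrix e (T i)‖ ≤ C) :
    ‖∑ i, TensorProduct.mapL (T i) (ρ (s i))‖ ≤ C := by
  refine ContinuousLinearMap.opNorm_le_bound _ hC fun z => ?_
  set X := ∑ i, TensorProduct.mapL (T i) (ρ (s i)) with hX
  obtain ⟨n, e, he, y', z', hy, hz⟩ := exists_orthonormal_sum_tmul (X z) z
  have hinner : inner ℂ (X z) (X z) = ∑ k, ∑ l, inner ℂ (y' k)
      (ρ (semicircularMatrix s (fun i => compressionMatrix e (T i)) k l) (z' l)) := by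
    conv_lhs => enter [2]; rw [hy]
    conv_lhs => enter [3]; rw [hz, hX]
    simp only [sum_inner, map_sum, sum_apply, inner_sum,
      TensorProduct.mapL_tmul, TensorProduct.inner_tmul, semicircularMatrix_apply, map_smul,
      smul_apply, inner_smul_right,
      compressionMatrix, Matrix.of_apply]
    exact (Finset.sum_congr rfl fun _ _ => Finset.sum_comm).trans Finset.sum_comm
  have h1 := norm_sum_inner_le ρ (semicircularMatrix s fun i => compressionMatrix e (T i)) y' z'
  rw [← hinner, ← he.norm_sum_tmul, ← he.norm_sum_tmul, ← hy, ← hz, inner_self_eq_norm_sq_to_K,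
    norm_pow, RCLike.norm_ofReal, abs_norm, sq] at h1
  by_cases h0 : ‖X z‖ = 0
  · rw [h0]
    positivity
  have hpos : 0 < ‖X z‖ := lt_of_le_of_ne (norm_nonneg _) (Ne.symm h0)
  refine le_of_mul_le_mul_left ?_ hpos
  calc _ ≤ _ := h1
    _ ≤ C * ‖X z‖ * ‖z‖ := by gcongr; exact h n e he
    _ = _ := by ring

end Tensor

/-! ### The norm bound -/

theorem theorem1p4 {L : ℕ} (G : SimpleGraph (Fin L))
    {A : Type*} [CStarAlgebra A] (τ : A →ₗ[ℂ] ℂ) (hτ : IsFaithfulTrace τ)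
    (s : Fin L → A) (hs : ∀ i, IsSemicircular τ (s i)) (hG : GIndependentElements τ G s)
    {H : Type*} [NormedAddCommGroup H] [InnerProductSpace ℂ H] [CompleteSpace H]
    (a : Fin L → (H →L[ℂ] H)) :
    minTensorNorm (∑ i, a i ⊗ₜ[ℂ] s i) ≤
      2 * √(G.cliqueNum : ℝ) *
        max (√‖∑ i, a i * star (a i)‖) (√‖∑ i, star (a i) * a i‖) := by
  let _ := CStarAlgebra.spectralOrder A
  have := CStarAlgebra.spectralOrderedRing A
  set c : NNReal := max ‖∑ i, a i * star (a i)‖₊ ‖∑ i, star (a i) * a i‖₊ with hc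
  have hbound : 2 * √(G.cliqueNum : ℝ) *
      max (√‖∑ i, a i * star (a i)‖) (√‖∑ i, star (a i) * a i‖) =
        √(4 * G.cliqueNum * c) := by
    rw [Real.sqrt_mul (by positivity), Real.sqrt_mul (by positivity), hc, NNReal.coe_max,
      (Real.sqrt_monotone).map_max, coe_nnnorm, coe_nnnorm,
      show (4 : ℝ) = 2 ^ 2 by norm_num, Real.sqrt_sq (by norm_num)]
  rw [hbound]
  refine Real.sSup_le ?_ (Real.sqrt_nonneg _)
  rintro r ⟨H', _, _, _, K, _, _, _, π, ρ, rfl⟩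
  have hrep : tensorRep π ρ (∑ i, a i ⊗ₜ[ℂ] s i) =
      ∑ i, TensorProduct.mapL (π (a i)) (ρ (s i)) := by
    rw [map_sum]
    rfl
  rw [hrep]
  refine opNorm_le_of_forall_compression ρ (fun i => π (a i)) s (Real.sqrt_nonneg _) ?_
  intro n e he
  have h1 : ‖∑ i, π (a i) * star (π (a i))‖ ≤ c := by
    have : ∑ i, π (a i) * star (π (a i)) = π (∑ i, a i * star (a i)) := by
      rw [map_sum]
      exact Finset.sum_congr rfl fun i _ => by rw [map_mul, map_star]
    rw [this]
    exact (NonUnitalStarAlgHom.norm_apply_le π _).trans (le_max_left _ _)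
  have h2 : ‖∑ i, star (π (a i)) * π (a i)‖ ≤ c := by
    have : ∑ i, star (π (a i)) * π (a i) = π (∑ i, star (a i) * a i) := by
      rw [map_sum]
      exact Finset.sum_congr rfl fun i _ => by rw [map_mul, map_star]
    rw [this]
    exact (NonUnitalStarAlgHom.norm_apply_le π _).trans (le_max_right _ _)
  refine Real.le_sqrt_of_sq_le (norm_semicircularMatrix_le hτ hs hG _ c ?_ ?_ ?_ ?_)
  · intro x
    have := he.sum_norm_compressionMatrix_sq_le (fun i => π (a i)) x
    rw [← NNReal.coe_le_coe]
    push_cast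
    exact this.trans (mul_le_mul_of_nonneg_right h2 (by positivity))
  · intro x
    have := he.norm_sum_compressionMatrix_sq_le (fun i => π (a i)) x
    rw [← NNReal.coe_le_coe]
    push_cast
    exact this.trans (mul_le_mul_of_nonneg_right h1 (by positivity))
  · intro x
    have := he.sum_norm_compressionMatrix_sq_le (fun i => star (π (a i))) x
    simp only [star_star] at this
    simp only [compressionMatrix_conjTranspose]
    rw [← NNReal.coe_le_coe]
    push_cast
    exact this.trans (mul_le_mul_of_nonneg_right h1 (by positivity))
  · intro x
    have := he.norm_sum_compressionMatrix_sq_le (fun i => star (π (a i))) x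
    simp only [star_star] at this
    simp only [compressionMatrix_conjTranspose]
    rw [← NNReal.coe_le_coe]
    push_cast
    exact this.trans (mul_le_mul_of_nonneg_right h2 (by positivity))
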